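/- A server holds $N$ independent files $W_1,\dots,W_N$, each uniformly distributed on $\{0,1\}^F$, and serves $K>N$ users; user $k$ has a cache of $M_kF$ bits, where $0\le M_1\le M_2\le\cdots\le M_K<N$. A caching and delivery code consists of caching functions $Z_k=\phi_k(W_{[1:N]})$, an encoding function $X=\psi(W_{[1:N]},d_{[1:K]})$ and decoding functions $\hat W_{d_k}=\rho_k(Z_k,X,d_{[1:K]})$, where $d_k\in\{1,\dots,N\}$ is the demand of user $k$. Its error probability is $P_e=\max_{d_{[1:K]}}\Pr\{\exists k:\hat W_{d_k}\ne W_{d_k}\}$, and its (worst-case) rate is the length in bits of $X$ divided by $F$. A rate $R$ is achievable if for every $\varepsilon>0$ and all sufficiently large $F$ there is a code whose caches $Z_k$ have at most $M_kF$ bits, whose rate is at most $R+\varepsilon$, and for which $P_e<\varepsilon$. The group-based decentralized (GBD) scheme is the following. Placement: each user $k$ caches a uniformly random set of $\lfloor M_kF/N\rfloor$ bits of each file, independently over users and files. For $\mathcal V\subset\{1,\dots,K\}$, let $W_{i,\mathcal V}$ be the string of those bits of $W_i$ cached by all users in $\mathcal V$ and by no other user; let $\bar\oplus$ be bitwise XOR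 after zero-padding to the longest argument; and for each requested file $i$ let $\mathcal G_i$ be the group of users requesting it, listed in increasing order of index (hence of nondecreasing cache capacity). Coded delivery sends: (1) $W_{i,\emptyset}$ for each requested file $i$; (2) for each requested file $i$ and each pair $k,k'$ of consecutive users of $\mathcal G_i$, the string $W_{i,\{k\}}\bar\oplus W_{i,\{k'\}}$; and, for any two requested files $i<j$, the strings $W_{i,\{k\}}\bar\oplus W_{i,\{k'\}}$ for consecutive users $k,k'$ of $\mathcal G_j$, the strings $W_{j,\{k\}}\bar\oplus W_{j,\{k'\}}$ for consecutive users $k,k'$ of $\mathcal G_i$, and $W_{i,\{b\}}\bar\oplus W_{j,\{a\}}$, where $a$ and $b$ are the first users of $\mathcal G_i$ and $\mathcal G_j$; (3) $\overline{\bigoplus}_{v\in\mathcal V}W_{d_v,\mathcal V\setminus\{v\}}$ for each $\mathcal V$ with $|\mathcal V|\ge 3$. Random delivery sends, for each requested file $i$, uniformly random linear combinations over $\mathbb F_2$ of the bits of $W_i$, whose number is the largest number of bits of $W_i$ missing at a user of $\mathcal G_i$ plus a constant $s$. The server uses the procedure with the shorter message, and shorter messages are zero-padded to the largest length over all demands.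 The cached positions and the coefficients of the combinations are known to the server and the users. **Theorem 1.** Let $$R_{\mathrm{GBD}}=\min\Big\{\sum_{i=1}^K\prod_{j=1}^i\Big(1-\frac{M_j}{N}\Big)-\Delta R_1-\Delta R_2,\ \sum_{i=1}^N\Big(1-\frac{M_i}{N}\Big)\Big\},$$ where $$\Delta R_1=(K-N)\prod_{l=1}^K\Big(1-\frac{M_l}{N}\Big),\qquad \Delta R_2=\Big[\sum_{k=1}^{K-N}(k-1)\frac{M_{k+N}}{N-M_{k+N}}\Big]\prod_{l=1}^K\Big(1-\frac{M_l}{N}\Big).$$ The GBD scheme achieves $R_{\mathrm{GBD}}$: for every $\varepsilon>0$ there is an $s$ such that, for all sufficiently large $F$, with probability greater than $1-\varepsilon$ over the random placement and the random linear combinations, the resulting code (with suitable decoding functions) respects the cache capacities, has worst-case rate at most $R_{\mathrm{GBD}}+\varepsilon$, and has $P_e<\varepsilon$. In particular, the rate $R_{\mathrm{GBD}}$ is achievable for the capacities $M_1,\dots,M_K$. -/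

import Mathlib

/-! Decentralized coded caching with distinct cache capacities: caching and delivery codes,
the group-based decentralized (GBD) scheme, and its delivery rate. -/

open Filter

namespace CodedCaching

/-- Probability of the event `p` under the uniform distribution on the finite type `Ω`. -/
noncomputable def uniformProb {Ω : Type*} (p : Ω → Prop) : ℝ :=
  (Nat.card {ω : Ω // p ω} : ℝ) / (Nat.card Ω : ℝ)

/-- Strings of `n` bits. -/
abbrev Bits (n : ℕ) : Type := Fin n → ZMod 2

/-- A library of `N` files of `F` bits each. -/
abbrev Library (N F : ℕ) : Type := Fin N → Bits F

/-- A demand combination: user `k` requests the file `d k`. -/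
abbrev Demand (N K : ℕ) : Type := Fin K → Fin N

/-! ### Caching and delivery codes -/

/-- A caching and delivery code `(φ, ψ, ρ)` for `N` files of `F` bits and `K` users: caching
functions `φ k`, one encoding function `ψ`, and decoding functions `ρ k`. -/
structure CachingCode (N K F : ℕ) where
  cacheLen : Fin K → ℕ
  msgLen : ℕ
  φ : (k : Fin K) → Library N F → Bits (cacheLen k)
  ψ : Library N F → Demand N K → Bits msgLen
  ρ : (k : Fin K) → Bits (cacheLen k) → Bits msgLen → Demand N K → Bits F

/-- The error probability: the maximum over all demand combinations of the probability, over
independent uniformly distributed files, that some user fails to recover its request. -/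
noncomputable def CachingCode.errorProb {N K F : ℕ} (c : CachingCode N K F) : ℝ :=
  ⨆ d : Demand N K,
    uniformProb fun W : Library N F => ∃ k, c.ρ k (c.φ k W) (c.ψ W d) d ≠ W (d k)

/-- The code respects the cache capacities `M k * F` bits, sends at most `(R + ε) * F` bits,
and has error probability less than `ε`. -/
def CachingCode.Attains {N K F : ℕ} (c : CachingCode N K F) (M : Fin K → ℝ) (R ε : ℝ) : Prop :=
  (∀ k, (c.cacheLen k : ℝ) ≤ M k * F) ∧ (c.msgLen : ℝ) ≤ (R + ε) * F ∧ c.errorProb < ε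

/-- The cache capacity-delivery rate tuple `(M, R)` is achievable: for every `ε > 0` and all
sufficiently large `F` there is a code within the capacities, of rate at most `R + ε`, and with
error probability less than `ε`. -/
def Achievable (N : ℕ) {K : ℕ} (M : Fin K → ℝ) (R : ℝ) : Prop :=
  ∀ ε : ℝ, 0 < ε → ∀ᶠ F : ℕ in atTop, ∃ c : CachingCode N K F, c.Attains M R ε

/-! ### Decentralized random placement -/

/-- The number of bits of each file that a user of capacity `M` (in files) caches. -/
noncomputable def cacheSize (N F : ℕ) (M : ℝ) : ℕ := ⌊M * F / N⌋₊

/-- A placement: for every user `k` and every file `i`, the set of the `m k` positions of the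
bits of file `i` that user `k` caches. Under the uniform distribution on this product these sets
are independent, and each of them is a uniformly random set of its size. -/
abbrev Placement (N F : ℕ) {K : ℕ} (m : Fin K → ℕ) : Type :=
  (k : Fin K) → Fin N → {S : Finset (Fin F) // S.card = m k}

/-- The cache contents of user `k`: its `m k` cached bits of each of the `N` files. -/
def cacheContents {N K F : ℕ} {m : Fin K → ℕ} (C : Placement N F m) (k : Fin K)
    (W : Library N F) : Bits (N * m k) := fun t =>
  let q := finProdFinEquiv.symm t
  W q.1 ((C k q.1).1.orderEmbOfFin (C k q.1).2 q.2)

/-- The subfile `W_{i,V}`: the bits of file `i` cached by all users in `V` and by no other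
user, in increasing order of position. -/
def subfile {N K F : ℕ} {m : Fin K → ℕ} (C : Placement N F m) (W : Library N F)
    (i : Fin N) (V : Finset (Fin K)) : List (ZMod 2) :=
  ((List.finRange F).filter fun p => ∀ k, p ∈ (C k i).1 ↔ k ∈ V).map (W i)

/-! ### Coded delivery -/

/-- Bitwise XOR of the strings `l v`, `v ∈ s`, after zero-padding them to the length of the
longest of them. -/
def padXor {ι : Type*} (s : Finset ι) (l : ι → List (ZMod 2)) : List (ZMod 2) :=
  List.ofFn fun t : Fin (s.sup fun v => (l v).length) => ∑ v ∈ s, (l v).getD t 0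

/-- Zero-padded XOR of two strings. -/
def padXor₂ (a b : List (ZMod 2)) : List (ZMod 2) :=
  padXor (Finset.univ : Finset (Fin 2)) ![a, b]

/-- The group of the users requesting file `i`, in increasing order of their indices (which is
an order of nondecreasing cache capacity when the users are numbered in such an order). -/
def group {N K : ℕ} (d : Demand N K) (i : Fin N) : List (Fin K) :=
  (List.finRange K).filter fun k => d k = i

section Delivery

variable {N K F : ℕ} {m : Fin K → ℕ} (C : Placement N F m) (W : Library N F) (d : Demand N K)

/-- Part 1: the bits of each requested file that nobody has cached. -/
def part1 : List (ZMod 2) :=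
  (List.finRange N).flatMap fun i => if group d i = [] then [] else subfile C W i ∅

/-- The strings `W_{i,{k}} ⊕ W_{i,{k'}}` for all pairs `k`, `k'` of consecutive users of `g`. -/
def chain (i : Fin N) (g : List (Fin K)) : List (ZMod 2) :=
  (g.zip g.tail).flatMap fun q => padXor₂ (subfile C W i {q.1}) (subfile C W i {q.2})

/-- Part 2, within the groups. -/
def part21 : List (ZMod 2) :=
  (List.finRange N).flatMap fun i => chain C W i (group d i)

/-- The exchange between the groups of the files `i` and `j`, if both are nonempty; `a` and `b`
are their first users. -/
def exchange (i j : Fin N) : List (ZMod 2) :=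
  match group d i, group d j with
  | a :: as, b :: bs =>
      chain C W i (b :: bs) ++ chain C W j (a :: as) ++
        padXor₂ (subfile C W i {b}) (subfile C W j {a})
  | _, _ => []

/-- Part 2, across the groups. -/
def part22 : List (ZMod 2) :=
  (List.finRange N).flatMap fun i =>
    ((List.finRange N).filter fun j => i < j).flatMap fun j => exchange C W d i j

/-- Part 3: the bits cached by more than one user. -/
noncomputable def part3 : List (ZMod 2) :=
  ((Finset.univ : Finset (Finset (Fin K))).filter fun V => 3 ≤ V.card).toList.flatMap fun V =>
    padXor V fun v => subfile C W (d v) (V.erase v)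

/-- The message of the coded delivery procedure. -/
noncomputable def codedDelivery : List (ZMod 2) :=
  part1 C W d ++ part21 C W d ++ part22 C W d ++ part3 C W d

/-! ### Random delivery -/

/-- Coefficients of the random linear combinations: `F + s` combinations of the `F` bits of
each file. -/
abbrev Combos (N F s : ℕ) : Type := Fin N → Fin (F + s) → Fin F → ZMod 2

variable {s : ℕ} (A : Combos N F s)

/-- The message of the random delivery procedure. For each requested file `i` it has as many
random linear combinations of the bits of that file as the largest number of bits that a user
requesting it misses, and `s` more (none if nobody requests it). -/
def randomDelivery : List (ZMod 2) :=
  (List.finRange N).flatMap fun i =>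
    ((List.finRange (F + s)).take
      ((Finset.univ.filter fun k => d k = i).sup fun k => F - m k + s)).map
        fun t => ∑ p, A i t p * W i p

/-- The server uses the procedure with the shorter message. -/
noncomputable def gbdMessage : List (ZMod 2) :=
  if (codedDelivery C W d).length ≤ (randomDelivery (m := m) W d A).length
  then codedDelivery C W d else randomDelivery (m := m) W d A

/-- The number of bits sent for the placement `C` and the coefficients `A`: the largest length of
the message over all demand combinations (and libraries, on which the length does not depend). -/
noncomputable def gbdMsgLen : ℕ :=
  (Finset.univ : Finset (Library N F × Demand N K)).sup fun q =>
    (gbdMessage C q.1 q.2 A).length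

/-- The code of the GBD scheme for the placement `C` and the coefficients `A`, with decoding
functions `ρ`. Messages shorter than the largest one are zero-padded. -/
noncomputable def gbdCode
    (ρ : (k : Fin K) → Bits (N * m k) → Bits (gbdMsgLen C A) → Demand N K → Bits F) :
    CachingCode N K F where
  cacheLen := fun k => N * m k
  msgLen := gbdMsgLen C A
  φ := cacheContents C
  ψ := fun W d t => (gbdMessage C W d A).getD t 0
  ρ := ρ

end Delivery

/-- The GBD scheme achieves the rate `R`: for every `ε > 0`, with suitably many extra random
linear combinations and for all sufficiently large `F`, with probability more than `1 - ε` over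
the decentralized random placement and the random linear combinations, the resulting code (with
suitable decoding functions) respects the cache capacities, has worst-case rate at most `R + ε`,
and has error probability less than `ε`. -/
def GBDAchieves (N : ℕ) {K : ℕ} (M : Fin K → ℝ) (R : ℝ) : Prop :=
  ∀ ε : ℝ, 0 < ε → ∃ s : ℕ, ∀ᶠ F : ℕ in atTop,
    1 - ε < uniformProb
      fun ω : Placement N F (fun k => cacheSize N F (M k)) × Combos N F s =>
        ∃ ρ, (gbdCode ω.1 ω.2 ρ).Attains M R ε

/-! ### The rate -/

/-- `(K - N) ∏_l (1 - M_l / N)`. -/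
noncomputable def deltaR₁ (N : ℕ) {K : ℕ} (M : Fin K → ℝ) : ℝ :=
  ((K : ℝ) - N) * ∏ l, (1 - M l / N)

/-- `[∑_{k=1}^{K-N} (k - 1) M_{k+N} / (N - M_{k+N})] ∏_l (1 - M_l / N)`; with users numbered
from `0`, the index `k - 1` runs from `0` and user `k + N` is `N + (k - 1)`. -/
noncomputable def deltaR₂ (N : ℕ) {K : ℕ} (M : Fin K → ℝ) : ℝ :=
  (∑ k : Fin (K - N), ((k : ℕ) : ℝ) *
      (M ⟨N + k, by omega⟩ / (N - M ⟨N + k, by omega⟩))) * ∏ l, (1 - M l / N)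

end CodedCaching

namespace CodedCaching

/-! Fix a typical outcome of the placement and of the coefficients: no subfile is much longer than
its mean, and the coefficients are `Resolving`. For such an outcome decoding is error-free and both
procedures have controlled length, so the theorem reduces to showing that typical outcomes are
likely.

Probability. A subfile length is a sum over positions of products of independent indicators. The
events at two positions are negatively correlated within each cache, so its variance is at most F
and Chebyshev applies (`uniformProb_subfileLen_le`). A nonzero file vanishing on the cached
positions is killed by all the combinations with probability 2^-(F - m + s), and there are fewer
than 2^(F - m) such files; a union bound leaves 2^-s (`uniformProb_not_injective_le`).

Decoding. No decoder is built by hand: it suffices that two libraries with the same cache contents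
and the same message agree on the requested file (`exists_decoding_functions`). For coded delivery,
chains spread one known subfile through a group, exchanges carry it to another group, and every XOR
of part 3 contains a single string unknown to a given user.

Length. Let y k bound the subfiles cached by user k alone. If A is the set of first users of the
groups, part 2 costs at most |A| times the weight outside A, plus the larger weight of each pair
inside A; the worst A consists of the first N users (`leader_sum_le`), which gives the coefficient
min b N for user b. In part 3 the longest string of V is the one that leaves out the user of V with
the smallest cache, and summing by that user telescopes into the products over initial segments
(`sum_topFrac`). Compared with the sum of these products, part 1 counts the uncached bits N rather
than K times, which is ΔR₁, and part 2 counts user b (numbered from 0) min b N rather than b times,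
which is ΔR₂ (`coded_rate_eq`). Random delivery is also worst when the groups start with the first N
users. The server sends the shorter message, hence the minimum. -/

open scoped BigOperators in
theorem uniformProb_eq_expect {Ω : Type*} [Fintype Ω] (p : Ω → Prop) [DecidablePred p] :
    uniformProb p = 𝔼 ω, if p ω then (1 : ℝ) else 0 := by
  rw [Fintype.expect_eq_sum_div_card, Finset.sum_boole, uniformProb, Nat.card_eq_fintype_card,
    Nat.card_eq_fintype_card, Fintype.card_subtype]

/-! ### Union bounds, Chebyshev and independence for uniform probabilities. -/

section UniformProb

open scoped BigOperators

variable {Ω : Type*} [Fintype Ω]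

theorem uniformProb_mono {p q : Ω → Prop} (h : ∀ ω, p ω → q ω) :
    uniformProb p ≤ uniformProb q := by
  classical
  rw [uniformProb_eq_expect, uniformProb_eq_expect]
  refine Finset.expect_le_expect fun ω _ => ?_
  by_cases hp : p ω
  · simp [hp, h ω hp]
  · rw [if_neg hp]; split_ifs <;> norm_num

theorem uniformProb_compl [Nonempty Ω] (p : Ω → Prop) :
    uniformProb p = 1 - uniformProb fun ω => ¬ p ω := by
  classical
  rw [uniformProb_eq_expect, uniformProb_eq_expect, eq_sub_iff_add_eq,
    ← Finset.expect_add_distrib, ← Fintype.expect_one (ι := Ω) (M := ℝ)]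
  refine Finset.expect_congr rfl fun ω _ => ?_
  by_cases hp : p ω <;> simp [hp]

theorem uniformProb_or_le (p q : Ω → Prop) :
    uniformProb (fun ω => p ω ∨ q ω) ≤ uniformProb p + uniformProb q := by
  classical
  rw [uniformProb_eq_expect, uniformProb_eq_expect, uniformProb_eq_expect,
    ← Finset.expect_add_distrib]
  refine Finset.expect_le_expect fun ω _ => ?_
  by_cases hp : p ω <;> by_cases hq : q ω <;> simp [hp, hq]

theorem uniformProb_exists_le {ι : Type*} [Fintype ι] (p : ι → Ω → Prop) :
    uniformProb (fun ω => ∃ i, p i ω) ≤ ∑ i, uniformProb (p i) := by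
  classical
  simp only [uniformProb_eq_expect, ← Finset.expect_sum_comm]
  refine Finset.expect_le_expect fun ω _ => ?_
  have h0 : ∀ i ∈ Finset.univ, (0 : ℝ) ≤ if p i ω then (1 : ℝ) else 0 := fun i _ => by
    split_ifs <;> norm_num
  split_ifs with h
  · obtain ⟨i, hi⟩ := h
    calc (1 : ℝ) = if p i ω then 1 else 0 := by simp [hi]
      _ ≤ _ := Finset.single_le_sum h0 (Finset.mem_univ i)
  · exact Finset.sum_nonneg h0

theorem uniformProb_exists_le_mul {ι : Type*} [Fintype ι] (p : ι → Ω → Prop) {c : ℝ}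
    (h : ∀ i, uniformProb (p i) ≤ c) :
    uniformProb (fun ω => ∃ i, p i ω) ≤ (Fintype.card ι : ℝ) * c :=
  (uniformProb_exists_le p).trans
    ((Finset.sum_le_sum fun i _ => h i).trans_eq (by simp))

theorem uniformProb_prod_le {Ω' : Type*} [Fintype Ω'] [Nonempty Ω] (p : Ω × Ω' → Prop) (c : ℝ)
    (h : ∀ a, uniformProb (fun b => p (a, b)) ≤ c) : uniformProb p ≤ c := by
  classical
  rw [uniformProb_eq_expect, ← Finset.univ_product_univ, Finset.expect_product]
  refine Finset.expect_le Finset.univ_nonempty fun a _ => ?_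
  rw [← uniformProb_eq_expect (fun b => p (a, b))]
  exact h a

theorem uniformProb_fst {Ω' : Type*} [Fintype Ω'] [Nonempty Ω'] (p : Ω → Prop) :
    uniformProb (fun ω : Ω × Ω' => p ω.1) = uniformProb p := by
  classical
  rw [uniformProb_eq_expect, ← Finset.univ_product_univ, Finset.expect_product,
    uniformProb_eq_expect]
  refine Finset.expect_congr rfl fun a _ => ?_
  exact Fintype.expect_const (ι := Ω') (if p a then (1 : ℝ) else 0)

/-- Chebyshev's inequality for the upper tail. -/
theorem uniformProb_upper_tail_le [Nonempty Ω] (X : Ω → ℝ) {μ v t : ℝ} (ht : 0 < t)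
    (h1 : 𝔼 ω, X ω = μ) (h2 : 𝔼 ω, X ω ^ 2 ≤ μ ^ 2 + v) :
    uniformProb (fun ω => μ + t < X ω) ≤ v / t ^ 2 := by
  classical
  rw [uniformProb_eq_expect]
  calc 𝔼 ω, (if μ + t < X ω then (1 : ℝ) else 0) ≤ 𝔼 ω, (X ω - μ) ^ 2 / t ^ 2 := by
        refine Finset.expect_le_expect fun ω _ => ?_
        split_ifs with h
        · rw [le_div_iff₀ (by positivity)]; nlinarith
        · positivity
    _ = (𝔼 ω, X ω ^ 2 - μ ^ 2) / t ^ 2 := by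
        rw [← Finset.expect_div]
        congr 1
        have : ∀ ω, (X ω - μ) ^ 2 = X ω ^ 2 - 2 * μ * X ω + μ ^ 2 := fun ω => by ring
        simp only [this]
        rw [Finset.expect_add_distrib, Finset.expect_sub_distrib, ← Finset.mul_expect, h1,
          Fintype.expect_const]
        ring
    _ ≤ v / t ^ 2 := by gcongr; linarith

theorem expect_pi_prod {ι : Type*} [Fintype ι] [DecidableEq ι] {α : ι → Type*}
    [∀ i, Fintype (α i)] (f : ∀ i, α i → ℝ) :
    𝔼 ω : ∀ i, α i, ∏ i, f i (ω i) = ∏ i, 𝔼 a, f i a := by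
  simp only [Fintype.expect_eq_sum_div_card, Finset.prod_div_distrib, Fintype.card_pi,
    Nat.cast_prod]
  rw [Finset.prod_univ_sum, Fintype.piFinset_univ]

theorem expect_pi_marginal {ι : Type*} [Fintype ι] [DecidableEq ι] {α : ι → Type*}
    [∀ i, Fintype (α i)] [∀ i, Nonempty (α i)] (i : ι) (f : α i → ℝ) :
    𝔼 ω : ∀ i, α i, f (ω i) = 𝔼 a, f a := by
  -- The product formula with every factor other than the i-th equal to 1.
  have h := expect_pi_prod (fun j a => if h : j = i then f (h ▸ a) else 1)
  have hl : ∀ ω : ∀ i, α i, (∏ j, if h : j = i then f (h ▸ ω j) else 1) = f (ω i) := fun ω => by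
    rw [Finset.prod_eq_single i]
    · simp
    · intro j _ hj; simp [hj]
    · simp
  simp only [hl] at h
  rw [h, Finset.prod_eq_single i]
  · simp
  · intro j _ hj; simp [hj]
  · simp

end UniformProb

/-! ### Uniformly random subsets of a given size -/

section Subsets

open scoped BigOperators

variable {F m : ℕ}

instance [h : Fact (m ≤ F)] : Nonempty {S : Finset (Fin F) // S.card = m} := by
  obtain ⟨S, -, hS⟩ := Finset.exists_subset_card_eq (s := (Finset.univ : Finset (Fin F))) (n := m)
    (by simpa using h.out)
  exact ⟨⟨S, hS⟩⟩

/-- The indicator of the event that the set `S` contains (`b = True`) or avoids (`b = False`)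
the position `p`. -/
noncomputable def hit (b : Prop) (p : Fin F) (S : {S : Finset (Fin F) // S.card = m}) : ℝ :=
  open scoped Classical in if p ∈ S.1 ↔ b then 1 else 0

/-- The probability that a random set of `m` out of `F` positions contains, or avoids, a given
position. -/
noncomputable def hitProb (F m : ℕ) (b : Prop) : ℝ :=
  open scoped Classical in if b then (m : ℝ) / F else 1 - (m : ℝ) / F

theorem hit_mul_self (b : Prop) (p : Fin F) (S : {S : Finset (Fin F) // S.card = m}) :
    hit b p S * hit b p S = hit b p S := by
  unfold hit; split_ifs <;> simp

theorem hit_nonneg (b : Prop) (p : Fin F) (S : {S : Finset (Fin F) // S.card = m}) :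
    0 ≤ hit b p S := by
  unfold hit; split_ifs <;> simp

theorem sum_hit (hF : 0 < F) (b : Prop) (S : {S : Finset (Fin F) // S.card = m}) :
    ∑ p, hit b p S = F * hitProb F m b := by
  classical
  have hF' : (F : ℝ) ≠ 0 := by positivity
  unfold hit hitProb
  rw [Finset.sum_boole]
  by_cases hb : b
  · simp [hb, S.2, mul_div_cancel₀, hF']
  · simp only [hb, iff_false, if_false]
    rw [Finset.filter_not, Finset.card_sdiff_of_subset (Finset.filter_subset _ _)]
    have : S.1.card ≤ F := by simpa using Finset.card_le_univ S.1
    rw [Finset.filter_mem_eq_inter, Finset.univ_inter, Nat.cast_sub (by simpa using this)]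
    simp [S.2]
    field_simp

theorem hitProb_mem_Icc (h : m ≤ F) (b : Prop) : hitProb F m b ∈ Set.Icc 0 1 := by
  have h1 : (m : ℝ) / F ≤ 1 := div_le_one_of_le₀ (by exact_mod_cast h) (by positivity)
  have h2 : (0 : ℝ) ≤ (m : ℝ) / F := by positivity
  unfold hitProb
  split_ifs <;> constructor <;> linarith

/-- The image of a set of positions under a permutation. -/
def permSubset (σ : Equiv.Perm (Fin F)) :
    {S : Finset (Fin F) // S.card = m} ≃ {S : Finset (Fin F) // S.card = m} :=
  σ.finsetCongr.subtypeEquiv fun S => by simp [Equiv.finsetCongr]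

/-- Permuting positions preserves the uniform distribution on subsets, so this equivariance makes
positions, and pairs of positions, exchangeable. -/
theorem hit_permSubset (σ : Equiv.Perm (Fin F)) (b : Prop) (p : Fin F)
    (S : {S : Finset (Fin F) // S.card = m}) : hit b (σ p) (permSubset σ S) = hit b p S := by
  have : σ p ∈ (permSubset σ S).1 ↔ p ∈ S.1 := by simp [permSubset, Equiv.finsetCongr]
  classical exact if_congr (by rw [this]) rfl rfl

/-- By symmetry every position has the same expectation, and the total number of hits is
deterministic. -/
theorem expect_hit (h : m ≤ F) (b : Prop) (p : Fin F) :
    𝔼 S : {S : Finset (Fin F) // S.card = m}, hit b p S = hitProb F m b := by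
  have : Fact (m ≤ F) := ⟨h⟩
  have hF : 0 < F := p.pos
  have hF' : (F : ℝ) ≠ 0 := by positivity
  have key : ∀ p', 𝔼 S : {S : Finset (Fin F) // S.card = m}, hit b p' S =
      𝔼 S : {S : Finset (Fin F) // S.card = m}, hit b p S := by
    intro p'
    refine Fintype.expect_equiv (permSubset (Equiv.swap p p')) _ _ fun S => ?_
    rw [← hit_permSubset (Equiv.swap p p') b p', Equiv.swap_apply_right]
  have hs : ∑ p', 𝔼 S : {S : Finset (Fin F) // S.card = m}, hit b p' S = F * hitProb F m b := by
    rw [← Finset.expect_sum_comm]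
    simp only [sum_hit hF, Fintype.expect_const]
  simp only [key, Finset.sum_const, Finset.card_univ, Fintype.card_fin, nsmul_eq_mul] at hs
  exact mul_left_cancel₀ hF' hs

/-- The events at two distinct positions are negatively correlated. -/
theorem expect_hit_mul_hit_le (h : m ≤ F) (b : Prop) {p p' : Fin F} (hp : p' ≠ p) :
    𝔼 S : {S : Finset (Fin F) // S.card = m}, hit b p S * hit b p' S ≤ hitProb F m b ^ 2 := by
  have : Fact (m ≤ F) := ⟨h⟩
  have hF : 0 < F := p.pos
  have hF1 : 1 < F := by
    rcases p with ⟨p, hp1⟩; rcases p' with ⟨p', hp2⟩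
    simp only [ne_eq, Fin.mk.injEq] at hp
    omega
  have hFr : (1 : ℝ) < F := by exact_mod_cast hF1
  set c := 𝔼 S : {S : Finset (Fin F) // S.card = m}, hit b p S * hit b p' S
  have key : ∀ q ≠ p, 𝔼 S : {S : Finset (Fin F) // S.card = m}, hit b p S * hit b q S = c := by
    intro q hq
    refine Fintype.expect_equiv (permSubset (Equiv.swap p' q)) _ _ fun S => ?_
    have e1 : Equiv.swap p' q p = p := Equiv.swap_apply_of_ne_of_ne hp.symm hq.symm
    have e2 : Equiv.swap p' q q = p' := Equiv.swap_apply_right _ _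
    rw [← hit_permSubset (Equiv.swap p' q) b p, ← hit_permSubset (Equiv.swap p' q) b q, e1, e2]
  have hs : ∑ q, 𝔼 S : {S : Finset (Fin F) // S.card = m}, hit b p S * hit b q S =
      hitProb F m b * (F * hitProb F m b) := by
    rw [← Finset.expect_sum_comm]
    simp only [← Finset.mul_sum, sum_hit hF, ← Finset.expect_mul, expect_hit h]
  rw [← Finset.add_sum_erase _ _ (Finset.mem_univ p),
    Finset.sum_congr rfl fun q hq => key q (Finset.ne_of_mem_erase hq)] at hs
  simp only [hit_mul_self, expect_hit h, Finset.sum_const, Finset.card_erase_of_mem,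
    Finset.mem_univ, Finset.card_univ, Fintype.card_fin, nsmul_eq_mul] at hs
  rw [Nat.cast_sub (by omega), Nat.cast_one] at hs
  obtain ⟨h0, h1⟩ := hitProb_mem_Icc h b
  -- With h the hit probability, `hs` reads h + (F - 1) c = F h², so the claim amounts to h² ≤ h.
  nlinarith [mul_nonneg h0 (sub_nonneg.2 h1)]

end Subsets

/-! ### Concentration of the subfile lengths. -/

section Concentration

open scoped BigOperators

variable {N K F : ℕ} {m : Fin K → ℕ}

/-- The number of bits in the subfile `W_{i,V}`. -/
def subfileLen (C : Placement N F m) (i : Fin N) (V : Finset (Fin K)) : ℕ :=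
  (Finset.univ.filter fun p => ∀ k, p ∈ (C k i).1 ↔ k ∈ V).card

theorem length_subfile (C : Placement N F m) (W : Library N F) (i : Fin N)
    (V : Finset (Fin K)) : (subfile C W i V).length = subfileLen C i V := by
  unfold subfile subfileLen
  rw [List.length_map, ← List.toFinset_card_of_nodup ((List.nodup_finRange F).filter _),
    List.toFinset_filter, List.toFinset_finRange]
  simp

theorem subfileLen_eq_sum (C : Placement N F m) (i : Fin N) (V : Finset (Fin K)) :
    (subfileLen C i V : ℝ) = ∑ p, ∏ k, hit (k ∈ V) p (C k i) := by
  classical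
  unfold subfileLen hit
  rw [Finset.card_filter, Nat.cast_sum]
  refine Finset.sum_congr rfl fun p _ => ?_
  by_cases h : ∀ k, p ∈ (C k i).1 ↔ k ∈ V
  · rw [if_pos h, Nat.cast_one]
    exact (Finset.prod_eq_one fun k _ => if_pos (h k)).symm
  · obtain ⟨k, hk⟩ := not_forall.1 h
    rw [if_neg h, Nat.cast_zero]
    exact (Finset.prod_eq_zero (Finset.mem_univ k) (if_neg hk)).symm

theorem placement_nonempty (h : ∀ k, m k ≤ F) : Nonempty (Placement N F m) :=
  have (k : Fin K) : Fact (m k ≤ F) := ⟨h k⟩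
  inferInstance

theorem expect_placement_prod (h : ∀ k, m k ≤ F) (i : Fin N)
    (f : ∀ k, {S : Finset (Fin F) // S.card = m k} → ℝ) :
    𝔼 C : Placement N F m, ∏ k, f k (C k i) = ∏ k, 𝔼 S, f k S := by
  have (k : Fin K) : Fact (m k ≤ F) := ⟨h k⟩
  rw [expect_pi_prod (fun k (c : Fin N → {S : Finset (Fin F) // S.card = m k}) => f k (c i))]
  exact Finset.prod_congr rfl fun k _ =>
    expect_pi_marginal (α := fun _ : Fin N => {S : Finset (Fin F) // S.card = m k}) i (f k)

theorem expect_subfileLen (h : ∀ k, m k ≤ F) (i : Fin N) (V : Finset (Fin K)) :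
    𝔼 C : Placement N F m, (subfileLen C i V : ℝ) = F * ∏ k, hitProb F (m k) (k ∈ V) := by
  simp only [subfileLen_eq_sum]
  rw [Finset.expect_sum_comm]
  simp only [expect_placement_prod h i fun k => hit (k ∈ V) _, expect_hit (h _)]
  simp

/-- Expand the square over pairs of positions. Negative correlation bounds the off-diagonal terms by
the squared mean of one position; each of the F diagonal terms exceeds this by at most 1. -/
theorem expect_subfileLen_sq_le (h : ∀ k, m k ≤ F) (i : Fin N) (V : Finset (Fin K)) :
    𝔼 C : Placement N F m, (subfileLen C i V : ℝ) ^ 2 ≤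
      (F * ∏ k, hitProb F (m k) (k ∈ V)) ^ 2 + F := by
  simp only [subfileLen_eq_sum, sq, Finset.sum_mul_sum, ← Finset.prod_mul_distrib]
  have hcomm : ∀ p p' : Fin F, 𝔼 C : Placement N F m,
      ∏ k, hit (k ∈ V) p (C k i) * hit (k ∈ V) p' (C k i) =
        ∏ k, 𝔼 S : {S : Finset (Fin F) // S.card = m k}, hit (k ∈ V) p S * hit (k ∈ V) p' S :=
    fun p p' => expect_placement_prod h i fun k S => hit (k ∈ V) p S * hit (k ∈ V) p' S
  simp only [Finset.expect_sum_comm, hcomm]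
  set a := ∏ k, hitProb F (m k) (k ∈ V) with ha
  have key : ∀ p p' : Fin F, ∏ k, 𝔼 S : {S : Finset (Fin F) // S.card = m k},
      hit (k ∈ V) p S * hit (k ∈ V) p' S ≤ a ^ 2 + if p = p' then 1 else 0 := by
    intro p p'
    have ha0 : 0 ≤ a ^ 2 := sq_nonneg _
    have h0 : ∀ k ∈ Finset.univ, 0 ≤ 𝔼 S : {S : Finset (Fin F) // S.card = m k},
        hit (k ∈ V) p S * hit (k ∈ V) p' S := fun k _ =>
      Finset.expect_nonneg fun S _ => mul_nonneg (hit_nonneg _ _ _) (hit_nonneg _ _ _)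
    by_cases hp : p = p'
    · subst hp
      rw [if_pos rfl]
      have : ∏ k, 𝔼 S : {S : Finset (Fin F) // S.card = m k},
          hit (k ∈ V) p S * hit (k ∈ V) p S ≤ 1 := by
        refine Finset.prod_le_one h0 fun k _ => ?_
        simp only [hit_mul_self, expect_hit (h k)]
        exact (hitProb_mem_Icc (h k) _).2
      linarith
    · rw [if_neg hp, add_zero, ha, ← Finset.prod_pow]
      exact Finset.prod_le_prod h0 fun k _ => expect_hit_mul_hit_le (h k) _ (Ne.symm hp)
  calc _ ≤ ∑ p : Fin F, ∑ p' : Fin F, (a ^ 2 + if p = p' then 1 else 0) :=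
        Finset.sum_le_sum fun p _ => Finset.sum_le_sum fun p' _ => key p p'
    _ = _ := by simp [Finset.sum_add_distrib]; ring

/-- The length of a subfile rarely exceeds its mean by a positive fraction of `F`. -/
theorem uniformProb_subfileLen_le (hF : 0 < F) (h : ∀ k, m k ≤ F) (i : Fin N)
    (V : Finset (Fin K)) {δ : ℝ} (hδ : 0 < δ) :
    uniformProb (fun C : Placement N F m =>
      F * ∏ k, hitProb F (m k) (k ∈ V) + δ * F < subfileLen C i V) ≤ 1 / (δ ^ 2 * F) := by
  have := placement_nonempty (N := N) h
  have hF' : (0 : ℝ) < F := by exact_mod_cast hF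
  refine (uniformProb_upper_tail_le (fun C : Placement N F m => (subfileLen C i V : ℝ))
    (mul_pos hδ hF') (expect_subfileLen h i V) (expect_subfileLen_sq_le h i V)).trans_eq ?_
  field_simp

end Concentration

/-! ### Random linear combinations -/

section RandomCombinations

open scoped BigOperators

/-- Flipping the coefficient at a coordinate where x is 1 is a measure-preserving bijection that
toggles the value of the sum. -/
theorem expect_dotProduct_eq_zero {n : ℕ} (x : Bits n) (hx : x ≠ 0) :
    𝔼 a : Bits n, (if ∑ p, a p * x p = 0 then (1 : ℝ) else 0) = 1 / 2 := by
  obtain ⟨p, hp⟩ := Function.ne_iff.1 hx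
  have hp1 : x p = 1 := by
    rcases (by decide : ∀ z : ZMod 2, z = 0 ∨ z = 1) (x p) with h | h
    · exact absurd h hp
    · exact h
  have hflip : 𝔼 a : Bits n, (if ∑ p, a p * x p = 0 then (1 : ℝ) else 0) =
      𝔼 a : Bits n, (1 - if ∑ p, a p * x p = 0 then (1 : ℝ) else 0) := by
    refine Fintype.expect_equiv (Equiv.addRight (Pi.single p 1)) _ _ fun a => ?_
    have : ∑ q, (a + Pi.single p 1 : Bits n) q * x q = ∑ q, a q * x q + 1 := by
      simp [add_mul, Finset.sum_add_distrib, hp1, Pi.single_apply]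
    simp only [Equiv.coe_addRight, this]
    generalize ∑ q, a q * x q = z
    revert z
    intro z
    rcases (by decide : ∀ z : ZMod 2, z = 0 ∨ z = 1) z with rfl | rfl
    · simp
    · have : (1 + 1 : ZMod 2) = 0 := by decide
      simp [this]
  rw [Finset.expect_sub_distrib, Fintype.expect_const] at hflip
  linarith

theorem uniformProb_combos_eq {N F s : ℕ} (i : Fin N) {T : ℕ} (hT : T ≤ F + s) (x : Bits F)
    (hx : x ≠ 0) :
    uniformProb (fun A : Combos N F s =>
      ∀ t : Fin (F + s), t.1 < T → ∑ p, A i t p * x p = 0) = (1 / 2) ^ T := by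
  classical
  rw [uniformProb_eq_expect, expect_pi_marginal (α := fun _ : Fin N => Fin (F + s) → Fin F → ZMod 2) i
    (fun B : Fin (F + s) → Fin F → ZMod 2 =>
      if ∀ t : Fin (F + s), t.1 < T → ∑ p, B t p * x p = 0 then (1 : ℝ) else 0)]
  have h1 : ∀ B : Fin (F + s) → Fin F → ZMod 2,
      (if ∀ t : Fin (F + s), t.1 < T → ∑ p, B t p * x p = 0 then (1 : ℝ) else 0) =
      ∏ t : Fin (F + s), if t.1 < T → ∑ p, B t p * x p = 0 then (1 : ℝ) else 0 := fun B => by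
    rw [Finset.prod_boole]; simp
  simp only [h1]
  rw [expect_pi_prod fun (t : Fin (F + s)) (b : Fin F → ZMod 2) =>
    if t.1 < T → ∑ p, b p * x p = 0 then (1 : ℝ) else 0]
  have h2 : ∀ t : Fin (F + s), 𝔼 b : Fin F → ZMod 2,
      (if t.1 < T → ∑ p, b p * x p = 0 then (1 : ℝ) else 0) = if t.1 < T then 1 / 2 else 1 := by
    intro t
    by_cases ht : t.1 < T
    · simp only [ht, true_imp_iff, if_true]; exact expect_dotProduct_eq_zero x hx
    · simp [ht]
  simp only [h2]
  rw [Fin.prod_univ_eq_prod_range (fun t => if t < T then (1 / 2 : ℝ) else 1),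
    ← Finset.prod_filter, Finset.prod_const]
  congr 1
  rw [show (Finset.range (F + s)).filter (· < T) = Finset.range T by
    ext t; simp; omega, Finset.card_range]

/-- Outside a set of `F - r` known positions, `r + s` random combinations determine a file with
probability at least `1 - 2 ^ (-s)`. -/
theorem uniformProb_not_injective_le {N F s : ℕ} (i : Fin N) (S : Finset (Fin F)) :
    uniformProb (fun A : Combos N F s => ∃ x : Bits F, x ≠ 0 ∧ (∀ p ∈ S, x p = 0) ∧
      ∀ t : Fin (F + s), t.1 < F - S.card + s → ∑ p, A i t p * x p = 0) ≤ (1 / 2) ^ s := by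
  classical
  let e : (Fin F → ZMod 2) → Prop := fun x => x ≠ 0 ∧ ∀ p ∈ S, x p = 0
  -- This count cancels all but s factors 1/2 in the union bound.
  have hcard : Fintype.card {x // e x} ≤ 2 ^ (F - S.card) := by
    have h1 : Fintype.card ({p // p ∉ S} → ZMod 2) = 2 ^ (F - S.card) := by
      rw [Fintype.card_fun, ZMod.card, Fintype.card_subtype_compl]
      simp
    rw [← h1]
    refine Fintype.card_le_of_injective (fun x p => x.1 p.1) fun x y hxy => ?_
    ext p
    by_cases hp : p ∈ S
    · rw [x.2.2 p hp, y.2.2 p hp]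
    · exact congrFun hxy ⟨p, hp⟩
  have hle : F - S.card + s ≤ F + s := by omega
  calc _ ≤ uniformProb (fun A : Combos N F s => ∃ x : {x // e x},
        ∀ t : Fin (F + s), t.1 < F - S.card + s → ∑ p, A i t p * x.1 p = 0) :=
        uniformProb_mono fun A ⟨x, h1, h2, h3⟩ => ⟨⟨x, h1, h2⟩, h3⟩
    _ ≤ ∑ x : {x // e x}, (1 / 2 : ℝ) ^ (F - S.card + s) :=
        (uniformProb_exists_le _).trans (Finset.sum_le_sum fun x _ =>
          (uniformProb_combos_eq i hle x.1 x.2.1).le)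
    _ = Fintype.card {x // e x} * (1 / 2 : ℝ) ^ (F - S.card + s) := by simp
    _ ≤ (2 : ℝ) ^ (F - S.card) * (1 / 2 : ℝ) ^ (F - S.card + s) := by
        gcongr; exact_mod_cast hcard
    _ = (1 / 2) ^ s := by rw [pow_add, ← mul_assoc, ← mul_pow]; norm_num

end RandomCombinations

/-! ### Zero-padded sums and concatenations -/

/-- A concatenated message can be cut back into its blocks, because block lengths depend on the
placement and the demand but not on the library. -/
theorem flatMap_inj_of_length_eq {α β : Type*} {l : List α} {f g : α → List β}
    (hlen : ∀ x ∈ l, (f x).length = (g x).length) (h : l.flatMap f = l.flatMap g) :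
    ∀ x ∈ l, f x = g x := by
  induction l with
  | nil => simp
  | cons a l ih =>
    rw [List.flatMap_cons, List.flatMap_cons] at h
    obtain ⟨h1, h2⟩ := List.append_inj h (hlen a (by simp))
    intro x hx
    rcases List.mem_cons.1 hx with rfl | hx
    · exact h1
    · exact ih (fun y hy => hlen y (by simp [hy])) h2 x hx

theorem length_flatMap_congr {α β : Type*} {l : List α} {f g : α → List β}
    (h : ∀ x ∈ l, (f x).length = (g x).length) :
    (l.flatMap f).length = (l.flatMap g).length := by
  rw [List.length_flatMap, List.length_flatMap]
  exact congrArg List.sum (List.map_congr_left h)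

theorem ext_getD_zero {a b : List (ZMod 2)} (hlen : a.length = b.length)
    (h : ∀ t < a.length, a.getD t 0 = b.getD t 0) : a = b := by
  refine List.ext_getElem hlen fun t ha hb => ?_
  have := h t ha
  rwa [List.getD_eq_getElem _ _ ha, List.getD_eq_getElem _ _ hb] at this

theorem length_padXor {ι : Type*} (s : Finset ι) (l : ι → List (ZMod 2)) :
    (padXor s l).length = s.sup fun v => (l v).length := by
  simp [padXor]

theorem getD_padXor {ι : Type*} (s : Finset ι) (l : ι → List (ZMod 2)) (t : ℕ) :
    (padXor s l).getD t 0 = ∑ v ∈ s, (l v).getD t 0 := by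
  by_cases ht : t < s.sup fun v => (l v).length
  · rw [List.getD_eq_getElem _ _ (by rwa [length_padXor])]
    simp [padXor]
  · rw [List.getD_eq_default _ _ (by rw [length_padXor]; omega)]
    refine (Finset.sum_eq_zero fun v hv => List.getD_eq_default _ _ ?_).symm
    have := Finset.le_sup (f := fun v => (l v).length) hv
    omega

/-- All but one of the strings can be cancelled from a zero-padded sum. -/
theorem padXor_cancel {ι : Type*} {s : Finset ι} {l l' : ι → List (ZMod 2)}
    (h : padXor s l = padXor s l') {v : ι} (hv : v ∈ s) (hlen : (l v).length = (l' v).length)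
    (hl : ∀ u ∈ s, u ≠ v → l u = l' u) : l v = l' v := by
  classical
  refine ext_getD_zero hlen fun t _ => ?_
  have ht := congrArg (fun z => List.getD z t 0) h
  simp only [getD_padXor] at ht
  rw [← Finset.add_sum_erase _ _ hv, ← Finset.add_sum_erase _ _ hv,
    Finset.sum_congr rfl fun u hu => by
      rw [hl u (Finset.mem_of_mem_erase hu) (Finset.ne_of_mem_erase hu)]] at ht
  exact add_right_cancel ht

theorem length_padXor₂ (a b : List (ZMod 2)) : (padXor₂ a b).length = max a.length b.length := by
  rw [padXor₂, length_padXor, Fin.univ_succ]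
  simp

theorem padXor₂_cancel_left {a b b' : List (ZMod 2)} (h : padXor₂ a b = padXor₂ a b')
    (hlen : b.length = b'.length) : b = b' :=
  padXor_cancel (l := ![a, b]) (l' := ![a, b']) h (Finset.mem_univ 1) hlen fun u _ hu => by
    fin_cases u
    · rfl
    · exact absurd rfl hu

theorem padXor₂_cancel_right {a a' b : List (ZMod 2)} (h : padXor₂ a b = padXor₂ a' b)
    (hlen : a.length = a'.length) : a = a' :=
  padXor_cancel (l := ![a, b]) (l' := ![a', b]) h (Finset.mem_univ 0) hlen fun u _ hu => by
    fin_cases u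
    · exact absurd rfl hu
    · rfl

/-! ### Decoding -/

theorem errorProb_eq_zero {N K F : ℕ} (c : CachingCode N K F)
    (h : ∀ d W k, c.ρ k (c.φ k W) (c.ψ W d) d = W (d k)) : c.errorProb = 0 := by
  refine (iSup_congr fun d => ?_).trans (Real.iSup_const_zero)
  have he : IsEmpty {W : Library N F // ∃ k, c.ρ k (c.φ k W) (c.ψ W d) d ≠ W (d k)} :=
    ⟨fun W => W.2.elim fun k hk => hk (h d W.1 k)⟩
  rw [uniformProb, Nat.card_eq_zero.2 (Or.inl he), Nat.cast_zero, zero_div]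

/-- Decoding functions exist as soon as the cache and the message determine the request. -/
theorem exists_decoding_functions {N K F : ℕ} {α : Fin K → Type*} {β : Type*}
    (φ : ∀ k, Library N F → α k) (ψ : Library N F → Demand N K → β)
    (h : ∀ k d W W', φ k W = φ k W' → ψ W d = ψ W' d → W (d k) = W' (d k)) :
    ∃ ρ : (k : Fin K) → α k → β → Demand N K → Bits F,
      ∀ k d W, ρ k (φ k W) (ψ W d) d = W (d k) := by
  classical
  refine ⟨fun k z y d => if h : ∃ W, φ k W = z ∧ ψ W d = y then h.choose (d k) else 0,
    fun k d W => ?_⟩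
  have hW : ∃ W', φ k W' = φ k W ∧ ψ W' d = ψ W d := ⟨W, rfl, rfl⟩
  beta_reduce
  rw [dif_pos hW]
  exact h k d _ _ hW.choose_spec.1 hW.choose_spec.2

section Decoding

variable {N K F : ℕ} {m : Fin K → ℕ} {C : Placement N F m} {d : Demand N K} {W W' : Library N F}

theorem length_subfile_eq (W W' : Library N F) (i : Fin N) (V : Finset (Fin K)) :
    (subfile C W i V).length = (subfile C W' i V).length := by
  simp only [length_subfile]

theorem length_padXor₂_subfile_eq (W W' : Library N F) (i j : Fin N) (U V : Finset (Fin K)) :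
    (padXor₂ (subfile C W i U) (subfile C W j V)).length =
      (padXor₂ (subfile C W' i U) (subfile C W' j V)).length := by
  simp only [length_padXor₂, length_subfile]

theorem length_chain_eq (W W' : Library N F) (i : Fin N) (g : List (Fin K)) :
    (chain C W i g).length = (chain C W' i g).length :=
  length_flatMap_congr fun _ _ => length_padXor₂_subfile_eq _ _ _ _ _ _

theorem length_exchange_eq (W W' : Library N F) (d : Demand N K) (i j : Fin N) :
    (exchange C W d i j).length = (exchange C W' d i j).length := by
  unfold exchange
  split
  · simp only [List.length_append, length_chain_eq W W', length_padXor₂_subfile_eq W W']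
  · rfl

theorem length_part1_eq (W W' : Library N F) (d : Demand N K) :
    (part1 C W d).length = (part1 C W' d).length :=
  length_flatMap_congr fun i _ => by
    split_ifs
    · rfl
    · exact length_subfile_eq W W' i ∅

theorem length_part21_eq (W W' : Library N F) (d : Demand N K) :
    (part21 C W d).length = (part21 C W' d).length :=
  length_flatMap_congr fun _ _ => length_chain_eq _ _ _ _

theorem length_part22_eq (W W' : Library N F) (d : Demand N K) :
    (part22 C W d).length = (part22 C W' d).length :=
  length_flatMap_congr fun _ _ => length_flatMap_congr fun _ _ => length_exchange_eq _ _ _ _ _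

theorem length_part3_eq (W W' : Library N F) (d : Demand N K) :
    (part3 C W d).length = (part3 C W' d).length :=
  length_flatMap_congr fun _ _ => by simp only [length_padXor, length_subfile]

theorem length_codedDelivery_eq (W W' : Library N F) (d : Demand N K) :
    (codedDelivery C W d).length = (codedDelivery C W' d).length := by
  simp only [codedDelivery, List.length_append, length_part1_eq W W', length_part21_eq W W',
    length_part22_eq W W', length_part3_eq W W']

theorem length_randomDelivery_eq {s : ℕ} (A : Combos N F s) (W W' : Library N F)
    (d : Demand N K) :
    (randomDelivery (m := m) W d A).length = (randomDelivery (m := m) W' d A).length :=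
  length_flatMap_congr fun _ _ => by simp only [List.length_map]

theorem subfile_eq_of_cached {k : Fin K} {i : Fin N}
    (h : ∀ p ∈ (C k i).1, W i p = W' i p) {V : Finset (Fin K)} (hk : k ∈ V) :
    subfile C W i V = subfile C W' i V := by
  refine List.map_congr_left fun p hp => h p ?_
  have := (List.mem_filter.1 hp).2
  exact ((of_decide_eq_true this) k).2 hk

/-- Position p lies in the subfile indexed by the set of all users that cache it. -/
theorem file_eq_of_subfile_eq {i : Fin N}
    (h : ∀ V : Finset (Fin K), subfile C W i V = subfile C W' i V) : W i = W' i := by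
  funext p
  have hV := h (Finset.univ.filter fun k => p ∈ (C k i).1)
  refine List.map_inj_left.1 hV p (List.mem_filter.2 ⟨List.mem_finRange p, ?_⟩)
  simp

/-- A chain makes either all or none of its subfiles known. -/
theorem subfile_eq_of_chain_eq {i : Fin N} {g : List (Fin K)}
    (h : chain C W i g = chain C W' i g) {k k' : Fin K} (hk : k ∈ g) (hk' : k' ∈ g)
    (hkk : subfile C W i {k} = subfile C W' i {k}) :
    subfile C W i {k'} = subfile C W' i {k'} := by
  induction g generalizing k k' with
  | nil => simp at hk
  | cons a g ih =>
    cases g with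
    | nil =>
      rw [List.mem_singleton] at hk hk'
      rwa [hk', ← hk]
    | cons b g =>
      obtain ⟨h1, h2⟩ := List.append_inj
        (s₁ := padXor₂ (subfile C W i {a}) (subfile C W i {b})) (t₁ := chain C W i (b :: g))
        (s₂ := padXor₂ (subfile C W' i {a}) (subfile C W' i {b})) (t₂ := chain C W' i (b :: g))
        h (length_padXor₂_subfile_eq _ _ _ _ _ _)
      have hab : subfile C W i {a} = subfile C W' i {a} →
          subfile C W i {b} = subfile C W' i {b} := fun ha =>
        padXor₂_cancel_left (by rw [h1, ha]) (length_subfile_eq _ _ _ _)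
      have hba : subfile C W i {b} = subfile C W' i {b} →
          subfile C W i {a} = subfile C W' i {a} := fun hb =>
        padXor₂_cancel_right (by rw [h1, hb]) (length_subfile_eq _ _ _ _)
      have hb : subfile C W i {b} = subfile C W' i {b} := by
        rcases List.mem_cons.1 hk with rfl | hk
        · exact hab hkk
        · exact ih h2 hk (by simp) hkk
      rcases List.mem_cons.1 hk' with rfl | hk'
      · exact hba hb
      · exact ih h2 (by simp) hk' hb

theorem mem_group {i : Fin N} {k : Fin K} : k ∈ group d i ↔ d k = i := by
  simp [group]

/-- User k has W_{j,{k}} cached. The chain of file j over its own group leads to W_{j,{a}}, the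
single XOR converts this to W_{i,{b}}, and the chain of file i over the other group leads to
W_{i,{k'}}. The other direction is the same path for user k'. -/
theorem subfile_eq_of_exchange_eq {i j : Fin N} (h : exchange C W d i j = exchange C W' d i j)
    {k k' : Fin K} (hk : d k = i) (hk' : d k' = j) :
    ((∀ p ∈ (C k i).1, W i p = W' i p) → (∀ p ∈ (C k j).1, W j p = W' j p) →
      subfile C W i {k'} = subfile C W' i {k'}) ∧
    ((∀ p ∈ (C k' i).1, W i p = W' i p) → (∀ p ∈ (C k' j).1, W j p = W' j p) →
      subfile C W j {k} = subfile C W' j {k}) := by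
  have hk1 := mem_group.2 hk
  have hk2 := mem_group.2 hk'
  unfold exchange at h
  cases hi : group d i with
  | nil => rw [hi] at hk1; simp at hk1
  | cons a as =>
    cases hj : group d j with
    | nil => rw [hj] at hk2; simp at hk2
    | cons b bs =>
      rw [hi, hj] at h
      rw [hi] at hk1
      rw [hj] at hk2
      simp only at h
      obtain ⟨h12, h3⟩ := List.append_inj' h (length_padXor₂_subfile_eq _ _ _ _ _ _)
      obtain ⟨h1, h2⟩ := List.append_inj h12 (length_chain_eq _ _ _ _)
      constructor
      · intro e1 e2
        have ha : subfile C W j {a} = subfile C W' j {a} :=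
          subfile_eq_of_chain_eq h2 hk1 (by simp) (subfile_eq_of_cached e2 (by simp))
        have hb : subfile C W i {b} = subfile C W' i {b} :=
          padXor₂_cancel_right (by rw [h3, ha]) (length_subfile_eq _ _ _ _)
        exact subfile_eq_of_chain_eq h1 (by simp) hk2 hb
      · intro e1 e2
        have hb : subfile C W i {b} = subfile C W' i {b} :=
          subfile_eq_of_chain_eq h1 hk2 (by simp) (subfile_eq_of_cached e1 (by simp))
        have ha : subfile C W j {a} = subfile C W' j {a} :=
          padXor₂_cancel_left (by rw [h3, hb]) (length_subfile_eq _ _ _ _)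
        exact subfile_eq_of_chain_eq h2 (by simp) hk1 ha

/-- A user recovers its request from its cache and the message of the coded delivery. -/
theorem file_eq_of_codedDelivery_eq {k : Fin K} (hc : ∀ i, ∀ p ∈ (C k i).1, W i p = W' i p)
    (h : codedDelivery C W d = codedDelivery C W' d) : W (d k) = W' (d k) := by
  obtain ⟨h, h3⟩ := List.append_inj' h (length_part3_eq _ _ _)
  obtain ⟨h, h22⟩ := List.append_inj' h (length_part22_eq _ _ _)
  obtain ⟨h1, h21⟩ := List.append_inj' h (length_part21_eq _ _ _)
  refine file_eq_of_subfile_eq (C := C) fun V => ?_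
  by_cases hk : k ∈ V
  · exact subfile_eq_of_cached (hc (d k)) hk
  rcases Nat.lt_trichotomy V.card 1 with hV | hV | hV
  · obtain rfl : V = ∅ := by rw [← Finset.card_eq_zero]; omega
    have := flatMap_inj_of_length_eq (fun i _ => by
      split_ifs
      · rfl
      · exact length_subfile_eq W W' i ∅) h1 (d k) (List.mem_finRange _)
    rwa [if_neg (List.ne_nil_of_mem (mem_group.2 rfl)),
      if_neg (List.ne_nil_of_mem (mem_group.2 rfl))] at this
  · obtain ⟨k', rfl⟩ := Finset.card_eq_one.1 hV
    have hex : ∀ i j, i < j → exchange C W d i j = exchange C W' d i j := fun i j hij =>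
      flatMap_inj_of_length_eq (fun _ _ => length_exchange_eq _ _ _ _ _)
        (flatMap_inj_of_length_eq (fun _ _ => length_flatMap_congr fun _ _ =>
          length_exchange_eq _ _ _ _ _) h22 i (List.mem_finRange _)) j
        (List.mem_filter.2 ⟨List.mem_finRange _, by simpa using hij⟩)
    rcases lt_trichotomy (d k) (d k') with hlt | heq | hlt
    · exact (subfile_eq_of_exchange_eq (hex _ _ hlt) rfl rfl).1 (hc _) (hc _)
    · exact subfile_eq_of_chain_eq (flatMap_inj_of_length_eq (fun _ _ => length_chain_eq _ _ _ _)
        h21 (d k) (List.mem_finRange _)) (mem_group.2 rfl) (mem_group.2 heq.symm)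
        (subfile_eq_of_cached (hc _) (by simp))
    · exact (subfile_eq_of_exchange_eq (hex _ _ hlt) rfl rfl).2 (hc _) (hc _)
  -- In the XOR for `insert k V`, every term of a user u ≠ k is a subfile whose index set contains
  -- k, hence is cached by k.
  · have hx := flatMap_inj_of_length_eq (fun V _ => by simp only [length_padXor, length_subfile]) h3
      (insert k V) (by simp [Finset.card_insert_of_notMem hk]; omega)
    have := padXor_cancel hx (Finset.mem_insert_self k V) (length_subfile_eq _ _ _ _)
      fun u _ hu => subfile_eq_of_cached (hc (d u))
        (Finset.mem_erase.2 ⟨hu.symm, Finset.mem_insert_self k V⟩)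
    simpa only [Finset.erase_insert hk] using this

/-- The coefficients `A` determine each file from the bits cached by any user and as many
combinations as the user misses bits, and `s` more. -/
def Resolving {s : ℕ} (C : Placement N F m) (A : Combos N F s) : Prop :=
  ∀ (i : Fin N) (k : Fin K) (x : Bits F), (∀ p ∈ (C k i).1, x p = 0) →
    (∀ t : Fin (F + s), t.1 < F - m k + s → ∑ p, A i t p * x p = 0) → x = 0

/-- By linearity `Resolving` applies to the difference of the two files. Enough combinations are
sent, since their number is a supremum over a group that contains k. -/
theorem file_eq_of_randomDelivery_eq {s : ℕ} {A : Combos N F s} (hA : Resolving C A)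
    {k : Fin K} (hc : ∀ i, ∀ p ∈ (C k i).1, W i p = W' i p)
    (h : randomDelivery (m := m) W d A = randomDelivery (m := m) W' d A) :
    W (d k) = W' (d k) := by
  have h1 := flatMap_inj_of_length_eq (fun _ _ => by simp only [List.length_map]) h (d k)
    (List.mem_finRange _)
  rw [← sub_eq_zero]
  refine hA (d k) k _ (fun p hp => by simp [hc _ p hp]) fun t ht => ?_
  have h2 := List.map_inj_left.1 h1 t (by
    rw [List.mem_take_iff_getElem]
    refine ⟨t.1, ?_, by simp⟩
    have := Finset.le_sup (f := fun k => F - m k + s)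
      (show k ∈ Finset.univ.filter fun k' => d k' = d k by simp)
    simp only [List.length_finRange]
    exact lt_min (ht.trans_le this) t.2)
  simp only [Pi.sub_apply, mul_sub, Finset.sum_sub_distrib, h2, sub_self]

theorem cached_eq_of_cacheContents_eq {k : Fin K}
    (h : cacheContents C k W = cacheContents C k W') (i : Fin N) :
    ∀ p ∈ (C k i).1, W i p = W' i p := by
  intro p hp
  obtain ⟨t, rfl⟩ : ∃ t, (C k i).1.orderEmbOfFin (C k i).2 t = p := by
    have : p ∈ Set.range ((C k i).1.orderEmbOfFin (C k i).2) := by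
      rw [Finset.range_orderEmbOfFin]; exact hp
    exact this
  simpa [cacheContents] using congrFun h (finProdFinEquiv (i, t))

theorem length_gbdMessage_eq {s : ℕ} (A : Combos N F s) (W W' : Library N F) (d : Demand N K) :
    (gbdMessage C W d A).length = (gbdMessage C W' d A).length := by
  simp only [gbdMessage, length_codedDelivery_eq W W', length_randomDelivery_eq A W W']
  split_ifs
  · exact length_codedDelivery_eq _ _ _
  · exact length_randomDelivery_eq _ _ _ _

theorem file_eq_of_gbdMessage_eq {s : ℕ} {A : Combos N F s} (hA : Resolving C A)
    {k : Fin K} (hc : cacheContents C k W = cacheContents C k W')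
    (h : gbdMessage C W d A = gbdMessage C W' d A) : W (d k) = W' (d k) := by
  -- The choice of procedure depends only on lengths, so both libraries take the same branch.
  simp only [gbdMessage, length_codedDelivery_eq W W', length_randomDelivery_eq A W W'] at h
  split_ifs at h
  · exact file_eq_of_codedDelivery_eq (cached_eq_of_cacheContents_eq hc) h
  · exact file_eq_of_randomDelivery_eq hA (cached_eq_of_cacheContents_eq hc) h

theorem length_gbdMessage_le {s : ℕ} (A : Combos N F s) (W : Library N F) (d : Demand N K) :
    (gbdMessage C W d A).length ≤ gbdMsgLen C A := by
  have h : ∀ q ∈ (Finset.univ : Finset (Library N F × Demand N K)),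
      (gbdMessage C q.1 q.2 A).length ≤ gbdMsgLen C A := fun q hq => by
    unfold gbdMsgLen
    exact Finset.le_sup hq
      (f := fun q : Library N F × Demand N K => (gbdMessage C q.1 q.2 A).length)
  exact h (W, d) (Finset.mem_univ _)

theorem exists_decoder {s : ℕ} {A : Combos N F s} (hA : Resolving C A) :
    ∃ ρ, (gbdCode C A ρ).errorProb = 0 := by
  have hdet : ∀ (k : Fin K) (d : Demand N K) (W W' : Library N F),
      cacheContents C k W = cacheContents C k W' →
      (fun t : Fin (gbdMsgLen C A) => (gbdMessage C W d A).getD t 0) =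
        (fun t : Fin (gbdMsgLen C A) => (gbdMessage C W' d A).getD t 0) →
      W (d k) = W' (d k) := fun k d W W' hc h =>
    file_eq_of_gbdMessage_eq hA hc (ext_getD_zero (length_gbdMessage_eq _ _ _ _) fun t ht =>
      congrFun h ⟨t, ht.trans_le (length_gbdMessage_le _ _ _)⟩)
  obtain ⟨ρ, hρ⟩ := exists_decoding_functions _ _ hdet
  exact ⟨ρ, errorProb_eq_zero (gbdCode C A ρ) fun d W k => hρ k d W⟩

end Decoding

/-! ### Sums over the first users of the groups -/

section Leaders

/-- The sum of a symmetric function over the pairs `i < j`. -/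
theorem sum_lt_pairs {α : Type*} [LinearOrder α] (L : Finset α) (g : α → α → ℝ)
    (hg : ∀ i j, g i j = g j i) :
    ∑ i ∈ L, ∑ j ∈ L, (if i < j then g i j else 0) =
      (∑ i ∈ L, ∑ j ∈ L, g i j - ∑ i ∈ L, g i i) / 2 := by
  have h1 : ∑ i ∈ L, ∑ j ∈ L, (if i < j then g i j else 0) =
      ∑ i ∈ L, ∑ j ∈ L, (if j < i then g i j else 0) := by
    rw [Finset.sum_comm]
    simp only [hg]
  have h2 : ∑ i ∈ L, g i i = ∑ i ∈ L, ∑ j ∈ L, (if i = j then g i j else 0) :=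
    Finset.sum_congr rfl fun i hi => by simp [hi]
  have h3 : ∑ i ∈ L, ∑ j ∈ L, g i j = ∑ i ∈ L, ∑ j ∈ L, (if i < j then g i j else 0) +
      ∑ i ∈ L, ∑ j ∈ L, (if j < i then g i j else 0) +
      ∑ i ∈ L, ∑ j ∈ L, (if i = j then g i j else 0) := by
    simp only [← Finset.sum_add_distrib]
    refine Finset.sum_congr rfl fun i _ => Finset.sum_congr rfl fun j _ => ?_
    rcases lt_trichotomy i j with h | h | h
    · simp [h, h.not_gt, h.ne]
    · simp [h]
    · simp [h, h.not_gt, h.ne']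
  rw [h3, h2, ← h1]
  ring

theorem le_val_of_strictMono {n K : ℕ} {e : Fin n → Fin K} (he : StrictMono e) (t : Fin n) :
    t.1 ≤ (e t).1 := by
  obtain ⟨t, ht⟩ := t
  induction t with
  | zero => exact Nat.zero_le _
  | succ t ih =>
    have := he (show (⟨t, by omega⟩ : Fin n) < ⟨t + 1, ht⟩ by simp)
    have h2 := ih (by omega)
    simp only [Fin.lt_def] at this h2 ⊢
    omega

/-- The sum of an antitone nonnegative function over at most `N` users is at most its sum over
the first `N` users. -/
theorem sum_le_sum_first {N K : ℕ} (h : N ≤ K) {f : Fin K → ℝ} (hf : Antitone f)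
    (hf0 : ∀ k, 0 ≤ f k) {A : Finset (Fin K)} (hA : A.card ≤ N) :
    ∑ a ∈ A, f a ≤ ∑ i : Fin N, f (Fin.castLE h i) := by
  calc ∑ a ∈ A, f a = ∑ t : Fin A.card, f (A.orderEmbOfFin rfl t) := by
        conv_lhs => rw [← Finset.map_orderEmbOfFin_univ A rfl, Finset.sum_map]
        rfl
    _ ≤ ∑ t : Fin A.card, f (Fin.castLE h (Fin.castLE hA t)) :=
        Finset.sum_le_sum fun t _ => hf (le_val_of_strictMono (A.orderEmbOfFin rfl).strictMono t)
    _ = ∑ i ∈ Finset.univ.map (Fin.castLEEmb hA), f (Fin.castLE h i) := by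
        rw [Finset.sum_map]; rfl
    _ ≤ _ := Finset.sum_le_sum_of_subset_of_nonneg (Finset.subset_univ _) fun i _ _ => hf0 _

theorem sum_range_sum_lt {K : ℕ} (N : ℕ) (y : Fin K → ℝ) :
    ∑ t ∈ Finset.range N, ∑ b : Fin K, (if t < b.1 then y b else 0) =
      ∑ b : Fin K, (min b.1 N : ℕ) * y b := by
  rw [Finset.sum_comm]
  refine Finset.sum_congr rfl fun b _ => ?_
  rw [← Finset.sum_filter, Finset.sum_const, nsmul_eq_mul]
  congr 2
  rw [show (Finset.range N).filter (· < b.1) = Finset.range (min b.1 N) by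
    ext t; simp; omega, Finset.card_range]

/-- Among all sets of at most `N` users, the first `N` maximize the weighted sum in which each
user outside the set counts `A.card` times and each pair inside it counts its maximum. -/
theorem leader_sum_le {N K : ℕ} {y : Fin K → ℝ} (hy : Monotone y) (hy0 : ∀ k, 0 ≤ y k)
    {A : Finset (Fin K)} (hA : A.card ≤ N) :
    A.card * (∑ k, y k - ∑ a ∈ A, y a) +
      (∑ a ∈ A, ∑ b ∈ A, max (y a) (y b) - ∑ a ∈ A, y a) / 2 ≤
      ∑ b : Fin K, (min b.1 N : ℕ) * y b := by
  have h1 : (∑ a ∈ A, ∑ b ∈ A, max (y a) (y b) - ∑ a ∈ A, y a) / 2 =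
      ∑ a ∈ A, (∑ b ∈ A, y b - ∑ b ∈ A, if b ≤ a then y b else 0) := by
    have := sum_lt_pairs A (fun a b => max (y a) (y b)) fun a b => max_comm _ _
    simp only [max_self] at this
    rw [← this]
    refine Finset.sum_congr rfl fun a _ => ?_
    rw [← Finset.sum_sub_distrib]
    refine Finset.sum_congr rfl fun b _ => ?_
    rcases lt_or_ge a b with h | h
    · simp [h, h.not_ge, hy h.le]
    · simp [h, h.not_gt]
  -- Charging each pair inside A to its smaller member, every a in A pays for all users except the
  -- members of A up to a.
  have h2 : (A.card : ℝ) * (∑ k, y k - ∑ a ∈ A, y a) +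
      (∑ a ∈ A, ∑ b ∈ A, max (y a) (y b) - ∑ a ∈ A, y a) / 2 =
      ∑ a ∈ A, (∑ k, y k - ∑ b ∈ A, if b ≤ a then y b else 0) := by
    rw [h1]
    simp only [Finset.sum_sub_distrib, Finset.sum_const, nsmul_eq_mul]
    ring
  rw [h2, ← sum_range_sum_lt]
  set e := A.orderEmbOfFin rfl
  have h3 : ∀ f : Fin K → ℝ, ∑ a ∈ A, f a = ∑ t : Fin A.card, f (e t) := fun f => by
    conv_lhs => rw [← Finset.map_orderEmbOfFin_univ A rfl, Finset.sum_map]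
    rfl
  have hcard : A.card ≤ K := by simpa using Finset.card_le_univ A
  -- The first t + 1 members of A weigh at least as much as the first t + 1 users, by monotonicity,
  -- so removing them leaves at most the users above t.
  have h4 : ∀ t : Fin A.card, ∑ k, y k - ∑ s : Fin A.card, (if e s ≤ e t then y (e s) else 0) ≤
      ∑ b : Fin K, (if t.1 < b.1 then y b else 0) := by
    intro t
    have h5 : ∑ b : Fin K, (if b.1 ≤ t.1 then y b else 0) ≤
        ∑ s : Fin A.card, (if e s ≤ e t then y (e s) else 0) := by
      simp only [OrderEmbedding.le_iff_le]
      calc ∑ b : Fin K, (if b.1 ≤ t.1 then y b else 0) =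
            ∑ s : Fin A.card, (if s ≤ t then y (Fin.castLE hcard s) else 0) := by
            symm
            refine Finset.sum_of_injOn (Fin.castLE hcard) (Fin.castLE_injective _).injOn
              (fun _ _ => Finset.mem_coe.2 (Finset.mem_univ _)) (fun b _ hb => ?_) fun s _ => rfl
            rw [if_neg]
            intro hbt
            exact hb ⟨⟨b.1, by omega⟩, by simp, rfl⟩
        _ ≤ _ := by
            refine Finset.sum_le_sum fun s _ => ?_
            split_ifs
            · exact hy (le_val_of_strictMono e.strictMono s)
            · exact le_rfl
    have h6 : ∑ k, y k = ∑ b : Fin K, (if b.1 ≤ t.1 then y b else 0) +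
        ∑ b : Fin K, (if t.1 < b.1 then y b else 0) := by
      rw [← Finset.sum_add_distrib]
      refine Finset.sum_congr rfl fun b _ => ?_
      rcases lt_or_ge t.1 b.1 with h | h
      · simp [h, h.not_ge]
      · simp [h, h.not_gt]
    linarith
  calc ∑ a ∈ A, (∑ k, y k - ∑ b ∈ A, if b ≤ a then y b else 0)
      = ∑ t : Fin A.card, (∑ k, y k - ∑ s : Fin A.card, (if e s ≤ e t then y (e s) else 0)) := by
        rw [h3]
        refine Finset.sum_congr rfl fun t _ => ?_
        rw [h3]
    _ ≤ ∑ t : Fin A.card, ∑ b : Fin K, (if t.1 < b.1 then y b else 0) :=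
        Finset.sum_le_sum fun t _ => h4 t
    _ = ∑ t ∈ Finset.range A.card, ∑ b : Fin K, (if t < b.1 then y b else 0) :=
        Fin.sum_univ_eq_sum_range (fun t => ∑ b : Fin K, (if t < b.1 then y b else 0)) _
    _ ≤ _ := by
        refine Finset.sum_le_sum_of_subset_of_nonneg (Finset.range_subset_range.2 hA) fun t _ _ =>
          Finset.sum_nonneg fun b _ => ?_
        split_ifs
        exacts [hy0 b, le_rfl]

end Leaders

/-! ### The length of the message -/

section Length

variable {N K F : ℕ} {m : Fin K → ℕ} {C : Placement N F m} (W : Library N F) (d : Demand N K)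

theorem group_pairwise (i : Fin N) : (group d i).Pairwise (· < ·) :=
  (List.pairwise_lt_finRange K).filter _

theorem sum_map_group (i : Fin N) (y : Fin K → ℝ) :
    ((group d i).map y).sum = ∑ k, if d k = i then y k else 0 := by
  rw [group, ← Finset.sum_filter, ← List.sum_toFinset _ ((List.nodup_finRange K).filter _)]
  congr 1
  ext k
  simp

/-- Along an increasing list the padded XOR of two neighbours is bounded by the weight of the later
one, so only the first user is not charged. -/
theorem length_chain_le {i : Fin N} {y : Fin K → ℝ} (hy : Monotone y)
    (h1 : ∀ k, (subfileLen C i {k} : ℝ) ≤ y k) {g : List (Fin K)} (hg : g.Pairwise (· < ·)) :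
    ((chain C W i g).length : ℝ) ≤ (g.tail.map y).sum := by
  induction g with
  | nil => simp [chain]
  | cons a g ih =>
    cases g with
    | nil => simp [chain]
    | cons b g =>
      have hcons : (chain C W i (a :: b :: g)).length =
          max (subfileLen C i {a}) (subfileLen C i {b}) + (chain C W i (b :: g)).length := by
        simp [chain, length_padXor₂, length_subfile]
      have hab : a < b := (List.pairwise_cons.1 hg).1 b (by simp)
      have := ih (List.pairwise_cons.1 hg).2
      rw [hcons]
      push_cast
      simp only [List.tail_cons, List.map_cons, List.sum_cons] at this ⊢
      have hmax := max_le ((h1 a).trans (hy hab.le)) (h1 b)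
      linarith

/-- The first user of the group of each requested file. -/
theorem exists_leaders (hK : 0 < K) : ∃ a : Fin N → Fin K, ∀ i ∈ Finset.univ.image d,
    group d i = a i :: (group d i).tail := by
  have : ∀ i, ∃ a : Fin K, i ∈ Finset.univ.image d → group d i = a :: (group d i).tail := by
    intro i
    cases h : group d i with
    | nil =>
      refine ⟨⟨0, hK⟩, fun hi => ?_⟩
      obtain ⟨k, -, hk⟩ := Finset.mem_image.1 hi
      have := mem_group.2 hk
      simp [h] at this
    | cons a as => exact ⟨a, fun _ => rfl⟩
  choose a ha using this
  exact ⟨a, ha⟩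

theorem group_eq_nil {i : Fin N} (hi : i ∉ Finset.univ.image d) : group d i = [] := by
  rw [List.eq_nil_iff_forall_not_mem]
  intro k hk
  exact hi (Finset.mem_image.2 ⟨k, Finset.mem_univ k, mem_group.1 hk⟩)

variable {d} in
theorem demand_leader {a : Fin N → Fin K}
    (ha : ∀ i ∈ Finset.univ.image d, group d i = a i :: (group d i).tail) {i : Fin N}
    (hi : i ∈ Finset.univ.image d) : d (a i) = i :=
  mem_group.1 (by rw [ha i hi]; simp)

variable {d} in
theorem leaders_injOn {a : Fin N → Fin K}
    (ha : ∀ i ∈ Finset.univ.image d, group d i = a i :: (group d i).tail) :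
    Set.InjOn a (Finset.univ.image d : Finset (Fin N)) := fun i hi j hj hij => by
  rw [← demand_leader ha hi, ← demand_leader ha hj, hij]

theorem length_part1_le {x₀ : ℝ} (h0 : ∀ i, (subfileLen C i ∅ : ℝ) ≤ x₀) :
    ((part1 C W d).length : ℝ) ≤ N * x₀ := by
  have h : (part1 C W d).length = ∑ i, if group d i = [] then 0 else subfileLen C i ∅ := by
    rw [part1, List.length_flatMap, Fin.sum_univ_def]
    congr 2
    funext i
    split_ifs <;> simp [length_subfile]
  rw [h, Nat.cast_sum]
  calc _ ≤ ∑ _i : Fin N, x₀ := Finset.sum_le_sum fun i _ => by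
        split_ifs
        · exact_mod_cast (Nat.cast_nonneg _).trans (h0 i)
        · exact h0 i
    _ = _ := by simp

theorem length_exchange_le {y : Fin K → ℝ} (hy : Monotone y)
    (h1 : ∀ i k, (subfileLen C i {k} : ℝ) ≤ y k) {i j : Fin N} {a b : Fin K}
    (ha : group d i = a :: (group d i).tail) (hb : group d j = b :: (group d j).tail) :
    ((exchange C W d i j).length : ℝ) ≤ ((group d i).tail.map y).sum +
      ((group d j).tail.map y).sum + max (y a) (y b) := by
  have e : exchange C W d i j = chain C W i (group d j) ++ chain C W j (group d i) ++
      padXor₂ (subfile C W i {b}) (subfile C W j {a}) := by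
    unfold exchange
    rw [ha, hb]
  rw [e, List.length_append, List.length_append, length_padXor₂, length_subfile, length_subfile]
  push_cast
  have e1 := length_chain_le W hy (h1 i) (group_pairwise d j)
  have e2 := length_chain_le W hy (h1 j) (group_pairwise d i)
  have e3 := max_le_max (h1 i b) (h1 j a)
  rw [max_comm (y b)] at e3
  linarith

theorem exchange_eq_nil {i j : Fin N}
    (h : i ∉ Finset.univ.image d ∨ j ∉ Finset.univ.image d) : exchange C W d i j = [] := by
  unfold exchange
  rcases h with h | h
  · rw [group_eq_nil d h]
  · rw [group_eq_nil d h]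
    split
    · rename_i heq; cases heq
    · rfl

/-- The non-leaders of a group are charged once in their own chain and once for each other requested
file, that is |L| times; each pair of leaders is charged its maximum. `leader_sum_le` bounds this
total. -/
theorem length_part2_le (hK : 0 < K) {y : Fin K → ℝ} (hy : Monotone y) (hy0 : ∀ k, 0 ≤ y k)
    (h1 : ∀ i k, (subfileLen C i {k} : ℝ) ≤ y k) :
    ((part21 C W d).length : ℝ) + (part22 C W d).length ≤
      ∑ b : Fin K, (min b.1 N : ℕ) * y b := by
  obtain ⟨a, ha⟩ := exists_leaders d hK
  set L := Finset.univ.image d with hL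
  set S : Fin N → ℝ := fun i => ((group d i).tail.map y).sum with hS
  have hSL : ∀ i ∉ L, S i = 0 := fun i hi => by simp [hS, group_eq_nil d hi]
  have h21 : ((part21 C W d).length : ℝ) ≤ ∑ i ∈ L, S i := by
    rw [part21, List.length_flatMap, ← Fin.sum_univ_def, Nat.cast_sum,
      Finset.sum_subset (Finset.subset_univ L) fun i _ hi => hSL i hi]
    exact Finset.sum_le_sum fun i _ => length_chain_le W hy (h1 i) (group_pairwise d i)
  have h22 : ((part22 C W d).length : ℝ) ≤ ∑ i ∈ L, ∑ j ∈ L,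
      if i < j then S i + S j + max (y (a i)) (y (a j)) else 0 := by
    have e : (part22 C W d).length =
        ∑ i, ∑ j, if i < j then (exchange C W d i j).length else 0 := by
      rw [part22, List.length_flatMap, ← Fin.sum_univ_def]
      refine Finset.sum_congr rfl fun i _ => ?_
      rw [List.length_flatMap, ← Finset.sum_filter,
        ← List.sum_toFinset _ ((List.nodup_finRange N).filter _)]
      congr 1
      ext j
      simp
    rw [e]
    push_cast
    rw [← Finset.sum_subset (Finset.subset_univ L) fun i _ hi => Finset.sum_eq_zero fun j _ => by
      simp [exchange_eq_nil W d (Or.inl hi)]]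
    refine Finset.sum_le_sum fun i hi => ?_
    rw [← Finset.sum_subset (Finset.subset_univ L) fun j _ hj => by
      simp [exchange_eq_nil W d (Or.inr hj)]]
    refine Finset.sum_le_sum fun j hj => ?_
    split_ifs
    · exact length_exchange_le W d hy h1 (ha i hi) (ha j hj)
    · simp
  rw [sum_lt_pairs L (fun i j => S i + S j + max (y (a i)) (y (a j))) fun i j => by
    rw [max_comm, add_comm (S i)]] at h22
  have hY : ∑ k, y k = ∑ i ∈ L, y (a i) + ∑ i ∈ L, S i := by
    rw [← Finset.sum_add_distrib]
    calc ∑ k, y k = ∑ k, ∑ i ∈ L, if d k = i then y k else 0 :=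
          Finset.sum_congr rfl fun k _ => by simp [hL]
      _ = ∑ i ∈ L, ∑ k, if d k = i then y k else 0 := Finset.sum_comm
      _ = _ := Finset.sum_congr rfl fun i hi => by
          rw [← sum_map_group, ha i hi]; simp [hS]
  have hinj : Set.InjOn a L := leaders_injOn ha
  have hcard : (L.image a).card = L.card := Finset.card_image_of_injOn hinj
  have key := leader_sum_le hy hy0 (A := L.image a) (N := N)
    (hcard.trans_le (by simpa using Finset.card_le_univ L))
  rw [hcard] at key
  simp only [Finset.sum_image hinj] at key
  simp only [Finset.sum_add_distrib, Finset.sum_const, nsmul_eq_mul, max_self,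
    ← Finset.mul_sum] at h22
  refine le_trans ?_ key
  rw [hY]
  nlinarith

theorem length_part3_le {z : Finset (Fin K) → ℝ}
    (h3 : ∀ i (V : Finset (Fin K)), 3 ≤ V.card → ∀ v ∈ V,
      (subfileLen C i (V.erase v) : ℝ) ≤ z V) :
    ((part3 C W d).length : ℝ) ≤
      ∑ V ∈ (Finset.univ : Finset (Finset (Fin K))).filter (3 ≤ ·.card), z V := by
  rw [part3, List.length_flatMap, Finset.sum_map_toList, Nat.cast_sum]
  refine Finset.sum_le_sum fun V hV => ?_
  have hV3 := (Finset.mem_filter.1 hV).2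
  have hne : V.Nonempty := Finset.card_pos.1 (by omega)
  simp only [length_padXor, length_subfile]
  obtain ⟨v, hv, he⟩ := Finset.exists_mem_eq_sup V hne
    fun v => subfileLen C (d v) (V.erase v)
  rw [he]
  exact h3 _ V hV3 v hv

theorem length_codedDelivery_le (hK : 0 < K) {x₀ : ℝ} {y : Fin K → ℝ} {z : Finset (Fin K) → ℝ}
    (hy : Monotone y) (hy0 : ∀ k, 0 ≤ y k) (h0 : ∀ i, (subfileLen C i ∅ : ℝ) ≤ x₀)
    (h1 : ∀ i k, (subfileLen C i {k} : ℝ) ≤ y k)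
    (h3 : ∀ i (V : Finset (Fin K)), 3 ≤ V.card → ∀ v ∈ V,
      (subfileLen C i (V.erase v) : ℝ) ≤ z V) :
    ((codedDelivery C W d).length : ℝ) ≤ N * x₀ + ∑ b : Fin K, (min b.1 N : ℕ) * y b +
      ∑ V ∈ (Finset.univ : Finset (Finset (Fin K))).filter (3 ≤ ·.card), z V := by
  have e1 := length_part1_le W d h0
  have e2 := length_part2_le W d hK hy hy0 h1
  have e3 := length_part3_le W d h3
  simp only [codedDelivery, List.length_append, Nat.cast_add]
  linarith

/-- The first user of a group misses the most bits, and the first users of different groups are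
distinct. -/
theorem length_randomDelivery_le (h : N ≤ K) (hK : 0 < K) (hm : Monotone m) {s : ℕ}
    (A : Combos N F s) :
    ((randomDelivery (m := m) W d A).length : ℝ) ≤
      ∑ i : Fin N, ((F - m (Fin.castLE h i) + s : ℕ) : ℝ) := by
  obtain ⟨a, ha⟩ := exists_leaders d hK
  set L := Finset.univ.image d with hL
  have hinj : Set.InjOn a L := leaders_injOn ha
  have hanti : Antitone fun k => ((F - m k + s : ℕ) : ℝ) := fun k k' hk => by
    have := hm hk
    simp only [Nat.cast_le]
    omega
  refine le_trans ?_ (sum_le_sum_first h hanti (fun k => Nat.cast_nonneg _) (A := L.image a)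
    (Finset.card_image_le.trans (by simpa using Finset.card_le_univ L)))
  rw [Finset.sum_image hinj, randomDelivery, List.length_flatMap, ← Fin.sum_univ_def,
    ← Nat.cast_sum, Nat.cast_le, ← Finset.sum_subset (Finset.subset_univ L)]
  · refine Finset.sum_le_sum fun i hi => ?_
    rw [List.length_map, List.length_take]
    refine (min_le_left _ _).trans (Finset.sup_le fun k hk => ?_)
    have hg : k ∈ group d i := mem_group.2 (Finset.mem_filter.1 hk).2
    have hp := group_pairwise d i
    rw [ha i hi] at hg hp
    have hle : a i ≤ k := by
      rcases List.mem_cons.1 hg with rfl | hk'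
      · exact le_rfl
      · exact ((List.pairwise_cons.1 hp).1 k hk').le
    have := hm hle
    omega
  · intro i _ hi
    have : (Finset.univ.filter fun k => d k = i) = ∅ :=
      Finset.filter_eq_empty_iff.2 fun k _ hk => hi (Finset.mem_image.2 ⟨k, Finset.mem_univ k, hk⟩)
    rw [List.length_map, List.length_take, this]
    simp

end Length

/-! ### The limiting fractions of the subfiles -/

section Fractions

variable {K : ℕ} {q : Fin K → ℝ}

/-- The limiting fraction of the bits of a file that are cached by exactly the users in `V`, when
user `k` caches the fraction `q k`. -/
noncomputable def subfileFrac (q : Fin K → ℝ) (V : Finset (Fin K)) : ℝ :=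
  ∏ k, if k ∈ V then q k else 1 - q k

/-- Factoring out the uncached fraction leaves a product of odds, which is what makes different V
comparable. -/
theorem subfileFrac_eq (hq1 : ∀ k, q k < 1) (V : Finset (Fin K)) :
    subfileFrac q V = (∏ k, (1 - q k)) * ∏ k ∈ V, q k / (1 - q k) := by
  rw [← Fintype.prod_ite_mem V, ← Finset.prod_mul_distrib, subfileFrac]
  refine Finset.prod_congr rfl fun k _ => ?_
  have := sub_pos.2 (hq1 k)
  split_ifs
  · field_simp
  · simp

theorem odds_monotone (hq : Monotone q) (hq1 : ∀ k, q k < 1) :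
    Monotone fun k => q k / (1 - q k) := fun j k hjk => by
  have h1 := sub_pos.2 (hq1 j)
  have h2 := sub_pos.2 (hq1 k)
  have h3 := hq hjk
  rw [div_le_div_iff₀ h1 h2]
  nlinarith

theorem subfileFrac_erase_le (hq : Monotone q) (hq0 : ∀ k, 0 ≤ q k) (hq1 : ∀ k, q k < 1)
    {V : Finset (Fin K)} {u v : Fin K} (hu : u ∈ V) (hv : v ∈ V) (huv : u ≤ v) :
    subfileFrac q (V.erase v) ≤ subfileFrac q (V.erase u) := by
  have h0 : ∀ k, 0 ≤ q k / (1 - q k) := fun k => div_nonneg (hq0 k) (sub_pos.2 (hq1 k)).le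
  rcases huv.eq_or_lt with rfl | huv
  · exact le_rfl
  rw [subfileFrac_eq hq1, subfileFrac_eq hq1,
    ← Finset.mul_prod_erase (V.erase v) _ (Finset.mem_erase.2 ⟨huv.ne, hu⟩),
    ← Finset.mul_prod_erase (V.erase u) _ (Finset.mem_erase.2 ⟨huv.ne', hv⟩),
    Finset.erase_right_comm]
  refine mul_le_mul_of_nonneg_left (mul_le_mul_of_nonneg_right (odds_monotone hq hq1 huv.le)
    (Finset.prod_nonneg fun k _ => h0 k)) (Finset.prod_nonneg fun k _ => (sub_pos.2 (hq1 k)).le)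

/-- The fraction of the bits cached by at least two users, all of them of index above `i`. -/
theorem sum_subfileFrac_Ioi (hq1 : ∀ k, q k < 1) (i : Fin K) :
    ∑ U ∈ (Finset.Ioi i).powerset.filter (2 ≤ ·.card), subfileFrac q U =
      ∏ j ∈ Finset.Iic i, (1 - q j) - ∏ k, (1 - q k) -
        (∏ k, (1 - q k)) * ∑ k ∈ Finset.Ioi i, q k / (1 - q k) := by
  -- Both sides are the fraction of bits cached by no user up to i; algebraically, the expansion of
  -- the product of the factors 1 + odds. The sets of size 0 and 1 are then removed.
  have hall : ∑ U ∈ (Finset.Ioi i).powerset, subfileFrac q U =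
      ∏ j ∈ Finset.Iic i, (1 - q j) := by
    simp only [subfileFrac_eq hq1]
    rw [← Finset.mul_sum, ← Finset.prod_one_add]
    have hc : (Finset.univ : Finset (Fin K)) = (Finset.Iic i).disjUnion (Finset.Ioi i)
        (Finset.disjoint_left.2 fun k h1 h2 => by simp at h1 h2; omega) := by
      ext k; simp [le_or_gt]
    rw [hc, Finset.prod_disjUnion, mul_assoc, ← Finset.prod_mul_distrib,
      Finset.prod_eq_one (s := Finset.Ioi i), mul_one]
    intro k _
    have := sub_pos.2 (hq1 k)
    field_simp
    ring
  have hsmall : (Finset.Ioi i).powerset.filter (fun U => ¬ 2 ≤ U.card) =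
      insert ∅ ((Finset.Ioi i).map ⟨singleton, Finset.singleton_injective⟩) := by
    ext U
    simp only [Finset.mem_filter, Finset.mem_powerset, Finset.mem_insert, Finset.mem_map,
      Function.Embedding.coeFn_mk]
    constructor
    · rintro ⟨h1, h2⟩
      rcases Nat.lt_or_ge U.card 1 with h | h
      · exact Or.inl (Finset.card_eq_zero.1 (by omega))
      · obtain ⟨k, rfl⟩ := Finset.card_eq_one.1 (show U.card = 1 by omega)
        exact Or.inr ⟨k, by simpa using h1, rfl⟩
    · rintro (rfl | ⟨k, hk, rfl⟩)
      · simp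
      · simpa using hk
  rw [← Finset.sum_filter_add_sum_filter_not _ (fun U => 2 ≤ U.card), hsmall,
    Finset.sum_insert (by simp), Finset.sum_map] at hall
  simp only [Function.Embedding.coeFn_mk, subfileFrac_eq hq1, Finset.prod_empty,
    Finset.prod_singleton, ← Finset.mul_sum] at hall ⊢
  linarith

/-- The largest of the fractions of the subfiles `V \ {v}`, obtained by leaving out the user of
smallest cache. -/
noncomputable def topFrac (q : Fin K → ℝ) (V : Finset (Fin K)) : ℝ :=
  ∑ i, if i ∈ V ∧ V.erase i ⊆ Finset.Ioi i then subfileFrac q (V.erase i) else 0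

theorem subfileFrac_nonneg (hq0 : ∀ k, 0 ≤ q k) (hq1 : ∀ k, q k < 1) (V : Finset (Fin K)) :
    0 ≤ subfileFrac q V :=
  Finset.prod_nonneg fun k _ => by
    split_ifs
    exacts [hq0 k, (sub_pos.2 (hq1 k)).le]

theorem subfileFrac_erase_le_topFrac (hq : Monotone q) (hq0 : ∀ k, 0 ≤ q k) (hq1 : ∀ k, q k < 1)
    {V : Finset (Fin K)} {v : Fin K} (hv : v ∈ V) : subfileFrac q (V.erase v) ≤ topFrac q V := by
  have hne : V.Nonempty := ⟨v, hv⟩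
  set u := V.min' hne
  have hu : u ∈ V := V.min'_mem hne
  refine (subfileFrac_erase_le hq hq0 hq1 hu hv (V.min'_le v hv)).trans ?_
  have hsub : V.erase u ⊆ Finset.Ioi u := fun k hk => by
    rw [Finset.mem_Ioi]
    exact V.min'_lt_of_mem_erase_min' hne hk
  calc subfileFrac q (V.erase u) =
        if u ∈ V ∧ V.erase u ⊆ Finset.Ioi u then subfileFrac q (V.erase u) else 0 := by
        rw [if_pos ⟨hu, hsub⟩]
    _ ≤ _ := Finset.single_le_sum (f := fun i => if i ∈ V ∧ V.erase i ⊆ Finset.Ioi i then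
        subfileFrac q (V.erase i) else 0) (fun i _ => by
          split_ifs
          exacts [subfileFrac_nonneg hq0 hq1 _, le_rfl]) (Finset.mem_univ u)

/-- In `topFrac` only i = min V contributes, so exchanging the sums classifies the V by their
smallest user. The odds of k are subtracted once for each of the `k.1` users below k. -/
theorem sum_topFrac (hq1 : ∀ k, q k < 1) :
    ∑ V ∈ (Finset.univ : Finset (Finset (Fin K))).filter (3 ≤ ·.card), topFrac q V =
      ∑ i, (∏ j ∈ Finset.Iic i, (1 - q j) - ∏ k, (1 - q k)) -
        (∏ k, (1 - q k)) * ∑ k : Fin K, (k.1 : ℝ) * (q k / (1 - q k)) := by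
  have h1 : ∀ i : Fin K, ∑ V ∈ (Finset.univ : Finset (Finset (Fin K))).filter (3 ≤ ·.card),
      (if i ∈ V ∧ V.erase i ⊆ Finset.Ioi i then subfileFrac q (V.erase i) else 0) =
      ∑ U ∈ (Finset.Ioi i).powerset.filter (2 ≤ ·.card), subfileFrac q U := by
    intro i
    rw [← Finset.sum_filter]
    refine Finset.sum_bij' (fun V _ => V.erase i) (fun U _ => insert i U) ?_ ?_ ?_ ?_ ?_
    · intro V hV
      simp only [Finset.mem_filter, Finset.mem_univ, true_and, Finset.mem_powerset] at hV ⊢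
      refine ⟨hV.2.2, ?_⟩
      rw [Finset.card_erase_of_mem hV.2.1]
      omega
    · intro U hU
      simp only [Finset.mem_filter, Finset.mem_univ, true_and, Finset.mem_powerset] at hU ⊢
      have hi : i ∉ U := fun h => by simpa using hU.1 h
      rw [Finset.card_insert_of_notMem hi, Finset.erase_insert hi]
      exact ⟨by omega, Finset.mem_insert_self _ _, hU.1⟩
    · intro V hV
      simp only [Finset.mem_filter] at hV
      exact Finset.insert_erase hV.2.1
    · intro U hU
      simp only [Finset.mem_filter, Finset.mem_powerset] at hU
      exact Finset.erase_insert fun h => by simpa using hU.1 h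
    · intro V hV
      rfl
  unfold topFrac
  rw [Finset.sum_comm]
  simp only [h1, sum_subfileFrac_Ioi hq1]
  rw [Finset.sum_sub_distrib, ← Finset.mul_sum]
  congr 2
  rw [Finset.sum_comm' (t' := Finset.univ) (s' := fun k => Finset.Iio k) (by simp)]
  refine Finset.sum_congr rfl fun k _ => ?_
  simp

/-- The rate of the coded delivery in terms of the odds `q k / (1 - q k)`. -/
theorem coded_rate_eq {N : ℕ} (h : N ≤ K) (hq1 : ∀ k, q k < 1) :
    N * subfileFrac q ∅ + ∑ b : Fin K, (min b.1 N : ℕ) * subfileFrac q {b} +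
      ∑ V ∈ (Finset.univ : Finset (Finset (Fin K))).filter (3 ≤ ·.card), topFrac q V =
      ∑ i, ∏ j ∈ Finset.Iic i, (1 - q j) - ((K : ℝ) - N) * ∏ k, (1 - q k) -
        (∑ k : Fin (K - N), ((k : ℕ) : ℝ) *
          (q ⟨N + k, by omega⟩ / (1 - q ⟨N + k, by omega⟩))) * ∏ k, (1 - q k) := by
  -- The weight b - min b N vanishes up to user N and equals k at user N + k.
  have h1 : ∑ k : Fin (K - N), ((k : ℕ) : ℝ) *
      (q ⟨N + k, by omega⟩ / (1 - q ⟨N + k, by omega⟩)) =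
      ∑ b : Fin K, ((b.1 : ℝ) - (min b.1 N : ℕ)) * (q b / (1 - q b)) := by
    refine Finset.sum_of_injOn (fun k : Fin (K - N) => (⟨N + k, by omega⟩ : Fin K)) ?_ ?_ ?_ ?_
    · intro k _ k' _ hk
      simp only [Fin.mk.injEq] at hk
      exact Fin.ext (by omega)
    · exact fun _ _ => Finset.mem_coe.2 (Finset.mem_univ _)
    · intro b _ hb
      have hbN : b.1 ≤ N := by
        by_contra hN
        exact hb ⟨⟨b.1 - N, by omega⟩, by simp, Fin.ext (by simp; omega)⟩
      rw [min_eq_left hbN, sub_self, zero_mul]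
    · intro k _
      simp
  rw [sum_topFrac hq1, h1]
  simp only [subfileFrac_eq hq1, Finset.prod_empty, Finset.prod_singleton, sub_mul,
    Finset.sum_sub_distrib, Finset.sum_const, Finset.card_univ, Fintype.card_fin, nsmul_eq_mul]
  have h2 : ∑ b : Fin K, ((min b.1 N : ℕ) : ℝ) * ((∏ k, (1 - q k)) * (q b / (1 - q b))) =
      (∏ k, (1 - q k)) * ∑ b : Fin K, ((min b.1 N : ℕ) : ℝ) * (q b / (1 - q b)) := by
    rw [Finset.mul_sum]
    exact Finset.sum_congr rfl fun b _ => by ring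
  rw [h2]
  ring

end Fractions

/-! ### The length of the message for typical placements -/

section Typical

variable {N K F : ℕ} {m : Fin K → ℕ} {C : Placement N F m}

/-- The slack δ per subfile costs N δ in part 1, at most K N δ in part 2, and at most 2^K δ in part
3, which has at most one string per set of users. -/
theorem length_codedDelivery_le_of_frac (hK : 0 < K) {q : Fin K → ℝ} (hq : Monotone q)
    (hq0 : ∀ k, 0 ≤ q k) (hq1 : ∀ k, q k < 1) {δ : ℝ} (hδ : 0 ≤ δ)
    (h : ∀ i V, (subfileLen C i V : ℝ) ≤ (subfileFrac q V + δ) * F) (W : Library N F)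
    (d : Demand N K) :
    ((codedDelivery C W d).length : ℝ) ≤
      (N * subfileFrac q ∅ + ∑ b : Fin K, (min b.1 N : ℕ) * subfileFrac q {b} +
        ∑ V ∈ (Finset.univ : Finset (Finset (Fin K))).filter (3 ≤ ·.card), topFrac q V +
        δ * (N + K * N + 2 ^ K)) * F := by
  have hF : (0 : ℝ) ≤ F := Nat.cast_nonneg F
  have hmono : Monotone fun k => (subfileFrac q {k} + δ) * (F : ℝ) := fun j k hjk => by
    have hP : 0 ≤ ∏ k, (1 - q k) := Finset.prod_nonneg fun k _ => (sub_pos.2 (hq1 k)).le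
    have := mul_le_mul_of_nonneg_left (odds_monotone hq hq1 hjk) hP
    simp only [subfileFrac_eq hq1, Finset.prod_singleton]
    gcongr
  have hnonneg : ∀ V, 0 ≤ (subfileFrac q V + δ) * (F : ℝ) := fun V =>
    mul_nonneg (add_nonneg (subfileFrac_nonneg hq0 hq1 V) hδ) hF
  refine (length_codedDelivery_le W d hK (z := fun V => (topFrac q V + δ) * F) hmono
    (fun k => hnonneg _) (fun i => h i ∅) (fun i k => h i {k}) fun i V _ v hv =>
      (h i _).trans ?_).trans ?_
  · gcongr
    exact subfileFrac_erase_le_topFrac hq hq0 hq1 hv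
  have e1 : ∑ b : Fin K, ((min b.1 N : ℕ) : ℝ) * ((subfileFrac q {b} + δ) * F) ≤
      (∑ b : Fin K, ((min b.1 N : ℕ) : ℝ) * subfileFrac q {b} + δ * (K * N)) * F := by
    rw [add_mul, Finset.sum_mul]
    calc _ ≤ ∑ b : Fin K, (((min b.1 N : ℕ) : ℝ) * subfileFrac q {b} * F + N * (δ * F)) := by
          refine Finset.sum_le_sum fun b _ => ?_
          have : ((min b.1 N : ℕ) : ℝ) * (δ * F) ≤ N * (δ * F) := by
            gcongr
            exact min_le_right _ _
          linarith
      _ = _ := by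
          rw [Finset.sum_add_distrib]
          simp
          ring
  have e2 : ∑ V ∈ (Finset.univ : Finset (Finset (Fin K))).filter (3 ≤ ·.card),
      (topFrac q V + δ) * F ≤
      (∑ V ∈ (Finset.univ : Finset (Finset (Fin K))).filter (3 ≤ ·.card), topFrac q V +
        δ * 2 ^ K) * F := by
    rw [← Finset.sum_mul, Finset.sum_add_distrib, Finset.sum_const, nsmul_eq_mul, mul_comm δ]
    gcongr
    have := Finset.card_filter_le (Finset.univ : Finset (Finset (Fin K))) (3 ≤ ·.card)
    rw [Finset.card_univ, Fintype.card_finset, Fintype.card_fin] at this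
    exact_mod_cast this
  linarith

theorem gbdMsgLen_le {s : ℕ} (A : Combos N F s) {c : ℝ} (hc : 0 ≤ c)
    (h : ∀ W d, ((codedDelivery C W d).length : ℝ) ≤ c ∨
      ((randomDelivery (m := m) W d A).length : ℝ) ≤ c) : (gbdMsgLen C A : ℝ) ≤ c := by
  rw [← Nat.le_floor_iff hc]
  unfold gbdMsgLen
  refine Finset.sup_le fun p _ => ?_
  rw [Nat.le_floor_iff hc]
  unfold gbdMessage
  split_ifs with hlen
  · rcases h p.1 p.2 with h | h
    · exact h
    · exact le_trans (by exact_mod_cast hlen) h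
  · rcases h p.1 p.2 with h | h
    · exact le_trans (by exact_mod_cast (not_le.1 hlen).le) h
    · exact h

end Typical

/-! ### The number of cached bits -/

section CacheSize

variable {N F : ℕ} {M : ℝ}

theorem cacheSize_le (hMN : M < N) : cacheSize N F M ≤ F := by
  unfold cacheSize
  refine Nat.floor_le_of_le (div_le_of_le_mul₀ (by positivity) (by positivity) ?_)
  rw [mul_comm]
  gcongr

theorem mul_cacheSize_le (hN : 0 < N) (hM : 0 ≤ M) : ((N * cacheSize N F M : ℕ) : ℝ) ≤ M * F := by
  have hN' : (0 : ℝ) < N := by exact_mod_cast hN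
  have h := Nat.floor_le (a := M * F / N) (by positivity)
  rw [le_div_iff₀ hN'] at h
  push_cast [cacheSize]
  linarith

theorem cacheSize_mono {M' : ℝ} (h : M ≤ M') : cacheSize N F M ≤ cacheSize N F M' := by
  unfold cacheSize
  gcongr

theorem sub_cacheSize_add_le (hMN : M < N) (s : ℕ) :
    ((F - cacheSize N F M + s : ℕ) : ℝ) ≤ (1 - M / N) * F + (s + 1) := by
  have h := Nat.lt_floor_add_one (M * F / N)
  rw [Nat.cast_add, Nat.cast_sub (cacheSize_le hMN), cacheSize]
  have : M / N * F = M * F / N := by ring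
  linarith

theorem tendsto_hitProb (hM : 0 ≤ M) (b : Prop) [Decidable b] :
    Tendsto (fun F : ℕ => hitProb F (cacheSize N F M) b) atTop
      (nhds (if b then M / N else 1 - M / N)) := by
  have h : Tendsto (fun F : ℕ => (cacheSize N F M : ℝ) / F) atTop (nhds (M / N)) := by
    have := (tendsto_nat_floor_mul_div_atTop (R := ℝ) (a := M / N) (by positivity)).comp
      tendsto_natCast_atTop_atTop
    refine this.congr fun F => ?_
    simp only [Function.comp_apply, cacheSize]
    congr 3
    ring
  unfold hitProb
  by_cases hb : b
  · simpa [hb] using h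
  · simpa [hb] using h.const_sub 1

theorem tendsto_prod_hitProb {K : ℕ} {M : Fin K → ℝ} (hM : ∀ k, 0 ≤ M k) (V : Finset (Fin K)) :
    Tendsto (fun F : ℕ => ∏ k, hitProb F (cacheSize N F (M k)) (k ∈ V)) atTop
      (nhds (subfileFrac (fun k => M k / N) V)) :=
  tendsto_finsetProd _ fun k _ => tendsto_hitProb (hM k) _

end CacheSize

/-! ### Typical placements and coefficients -/

section Typical

variable {N K F : ℕ} {m : Fin K → ℕ}

/-- A union bound over N 2^K subfiles and over N K pairs of a file and a user. For the latter the
placement is fixed first, the coefficients being independent of it. -/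
theorem typical_probability (hF : 0 < F) (h : ∀ k, m k ≤ F) (s : ℕ) {δ : ℝ} (hδ : 0 < δ) :
    1 - ((N * 2 ^ K : ℕ) * (1 / (δ ^ 2 * F)) + (N * K : ℕ) * (1 / 2) ^ s) ≤
      uniformProb fun ω : Placement N F m × Combos N F s =>
        (∀ i V, (subfileLen ω.1 i V : ℝ) ≤ F * ∏ k, hitProb F (m k) (k ∈ V) + δ * F) ∧
          Resolving ω.1 ω.2 := by
  have := placement_nonempty (N := N) h
  have h1 : uniformProb (fun ω : Placement N F m × Combos N F s => ∃ v : Fin N × Finset (Fin K),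
      F * ∏ k, hitProb F (m k) (k ∈ v.2) + δ * F < subfileLen ω.1 v.1 v.2) ≤
      (N * 2 ^ K : ℕ) * (1 / (δ ^ 2 * F)) := by
    have := uniformProb_exists_le_mul (Ω := Placement N F m × Combos N F s)
      (fun (v : Fin N × Finset (Fin K)) ω =>
        F * ∏ k, hitProb F (m k) (k ∈ v.2) + δ * F < subfileLen ω.1 v.1 v.2)
      fun v => (uniformProb_fst (Ω' := Combos N F s) (fun C : Placement N F m =>
        F * ∏ k, hitProb F (m k) (k ∈ v.2) + δ * F < subfileLen C v.1 v.2)).trans_le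
          (uniformProb_subfileLen_le hF h v.1 v.2 hδ)
    rwa [Fintype.card_prod, Fintype.card_finset, Fintype.card_fin, Fintype.card_fin] at this
  have h2 : uniformProb (fun ω : Placement N F m × Combos N F s => ∃ v : Fin N × Fin K,
      ∃ x : Bits F, x ≠ 0 ∧ (∀ p ∈ (ω.1 v.2 v.1).1, x p = 0) ∧ ∀ t : Fin (F + s),
        t.1 < F - (ω.1 v.2 v.1).1.card + s → ∑ p, ω.2 v.1 t p * x p = 0) ≤
      (N * K : ℕ) * (1 / 2) ^ s := by
    have := uniformProb_exists_le_mul (Ω := Placement N F m × Combos N F s)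
      (fun (v : Fin N × Fin K) ω =>
        ∃ x : Bits F, x ≠ 0 ∧ (∀ p ∈ (ω.1 v.2 v.1).1, x p = 0) ∧ ∀ t : Fin (F + s),
          t.1 < F - (ω.1 v.2 v.1).1.card + s → ∑ p, ω.2 v.1 t p * x p = 0)
      fun v => uniformProb_prod_le _ _ fun C =>
        uniformProb_not_injective_le v.1 (C v.2 v.1).1
    rwa [Fintype.card_prod, Fintype.card_fin, Fintype.card_fin] at this
  rw [uniformProb_compl]
  have h3 := (uniformProb_or_le _ _).trans (add_le_add h1 h2)
  refine sub_le_sub_left ((uniformProb_mono fun ω hω => ?_).trans h3) 1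
  by_contra hcon
  obtain ⟨hc1, hc2⟩ := not_or.1 hcon
  refine hω ⟨fun i V => not_lt.1 fun hlt => hc1 ⟨(i, V), hlt⟩, fun i k x hx1 hx2 => ?_⟩
  by_contra hx
  refine hc2 ⟨(i, k), x, hx, hx1, fun t ht => hx2 t ?_⟩
  rwa [(ω.1 k i).2] at ht

end Typical

/-! ### Assembly of the achieved rate. -/

theorem CachingCode.Attains.mono {N K F : ℕ} {c : CachingCode N K F} {M : Fin K → ℝ}
    {R ε ε' : ℝ} (h : c.Attains M R ε) (hε : ε ≤ ε') : c.Attains M R ε' :=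
  ⟨h.1, h.2.1.trans (by gcongr), h.2.2.trans_le hε⟩

theorem GBDAchieves.achievable {N K : ℕ} {M : Fin K → ℝ} {R : ℝ} (h : GBDAchieves N M R) :
    Achievable N M R := by
  intro ε hε
  -- Capping ε at 1 keeps the lower bound on the probability nonnegative, so some outcome yields a
  -- good code.
  obtain ⟨s, hs⟩ := h (min ε 1) (by positivity)
  filter_upwards [hs] with F hF
  have hpos : 0 < uniformProb fun ω : Placement N F (fun k => cacheSize N F (M k)) × Combos N F s =>
      ∃ ρ, (gbdCode ω.1 ω.2 ρ).Attains M R (min ε 1) :=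
    lt_of_le_of_lt (sub_nonneg.2 (min_le_right ε 1)) hF
  by_contra hcon
  have he : IsEmpty {ω : Placement N F (fun k => cacheSize N F (M k)) × Combos N F s //
      ∃ ρ, (gbdCode ω.1 ω.2 ρ).Attains M R (min ε 1)} :=
    ⟨fun ω => ω.2.elim fun ρ hρ => hcon ⟨_, hρ.mono (min_le_left _ _)⟩⟩
  rw [uniformProb, Nat.card_eq_zero.2 (Or.inl he), Nat.cast_zero, zero_div] at hpos
  exact hpos.false

/-- The rate of the coded delivery procedure in terms of the fractions of the subfiles. -/
theorem coded_rate_eq_sub_delta {N K : ℕ} (hN : 0 < N) (hNK : N ≤ K) {M : Fin K → ℝ}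
    (hMN : ∀ k, M k < N) :
    N * subfileFrac (fun k => M k / N) ∅ +
      ∑ b : Fin K, (min b.1 N : ℕ) * subfileFrac (fun k => M k / N) {b} +
      ∑ V ∈ (Finset.univ : Finset (Finset (Fin K))).filter (3 ≤ ·.card),
        topFrac (fun k => M k / N) V =
      ∑ i : Fin K, ∏ j ∈ Finset.Iic i, (1 - M j / N) - deltaR₁ N M - deltaR₂ N M := by
  have hN' : (0 : ℝ) < N := by exact_mod_cast hN
  rw [coded_rate_eq hNK fun k => (div_lt_one hN').2 (hMN k), deltaR₁, deltaR₂]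
  congr 2
  refine Finset.sum_congr rfl fun k _ => congrArg _ ?_
  field_simp

theorem gbdAchieves {N K : ℕ} (hN : 0 < N) (hNK : N ≤ K) {M : Fin K → ℝ} (hM : Monotone M)
    (hM0 : ∀ k, 0 ≤ M k) (hMN : ∀ k, M k < N) :
    GBDAchieves N M (min
      ((∑ i : Fin K, ∏ j ∈ Finset.Iic i, (1 - M j / N)) - deltaR₁ N M - deltaR₂ N M)
      (∑ i : Fin N, (1 - M (Fin.castLE hNK i) / N))) := by
  intro ε hε
  have hN' : (0 : ℝ) < N := by exact_mod_cast hN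
  have hq1 : ∀ k, M k / N < 1 := fun k => (div_lt_one hN').2 (hMN k)
  have hq0 : ∀ k, 0 ≤ M k / N := fun k => div_nonneg (hM0 k) hN'.le
  have hq : Monotone fun k => M k / N := fun j k hjk => by
    have := hM hjk
    simp only
    gcongr
  have hK : 0 < K := hN.trans_le hNK
  have hs : Tendsto (fun s : ℕ => ((N * K : ℕ) : ℝ) * (1 / 2) ^ s) atTop (nhds 0) := by
    simpa using (tendsto_pow_atTop_nhds_zero_of_lt_one (r := (1 / 2 : ℝ)) (by norm_num)
      (by norm_num)).const_mul ((N * K : ℕ) : ℝ)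
  obtain ⟨s, hs⟩ := (hs.eventually_lt_const (half_pos hε)).exists
  refine ⟨s, ?_⟩
  -- One δ absorbs the deviation of a subfile length above its mean, the other the gap between that
  -- mean and its limiting fraction.
  obtain ⟨δ, hδ, hδε⟩ : ∃ δ : ℝ, 0 < δ ∧ (δ + δ) * (N + K * N + 2 ^ K) ≤ ε := by
    have hD : (0 : ℝ) < N + K * N + 2 ^ K := by positivity
    refine ⟨ε / (2 * (N + K * N + 2 ^ K)), by positivity, le_of_eq ?_⟩
    field_simp
    ring
  have hfrac : ∀ᶠ F : ℕ in atTop, ∀ V : Finset (Fin K),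
      ∏ k, hitProb F (cacheSize N F (M k)) (k ∈ V) ≤ subfileFrac (fun k => M k / N) V + δ :=
    eventually_all.2 fun V => (tendsto_prod_hitProb hM0 V).eventually_le_const
      (lt_add_of_pos_right _ hδ)
  have hF1 : ∀ᶠ F : ℕ in atTop, ((N * 2 ^ K : ℕ) : ℝ) * (1 / (δ ^ 2 * F)) < ε / 2 := by
    have : Tendsto (fun F : ℕ => ((N * 2 ^ K : ℕ) : ℝ) / δ ^ 2 / F) atTop (nhds 0) :=
      tendsto_const_div_atTop_nhds_zero_nat _
    filter_upwards [this.eventually_lt_const (half_pos hε)] with F hF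
    rwa [mul_one_div, ← div_div]
  have hF2 : ∀ᶠ F : ℕ in atTop, (N : ℝ) * (s + 1) ≤ ε * F :=
    (tendsto_natCast_atTop_atTop.const_mul_atTop hε).eventually_ge_atTop _
  filter_upwards [hfrac, hF1, hF2, eventually_gt_atTop 0] with F hfrac hF1 hF2 hF
  have hm : ∀ k, cacheSize N F (M k) ≤ F := fun k => cacheSize_le (hMN k)
  refine lt_of_lt_of_le (by linarith) ((typical_probability (N := N) hF hm s hδ).trans
    (uniformProb_mono ?_))
  rintro ⟨C, A⟩ ⟨hC, hA⟩
  obtain ⟨ρ, hρ⟩ := exists_decoder hA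
  have hcoded : ∀ W d, ((codedDelivery C W d).length : ℝ) ≤
      (∑ i : Fin K, ∏ j ∈ Finset.Iic i, (1 - M j / N) - deltaR₁ N M - deltaR₂ N M + ε) * F := by
    intro W d
    refine (length_codedDelivery_le_of_frac hK hq hq0 hq1 (δ := δ + δ) (by positivity)
      (fun i V => (hC i V).trans ?_) W d).trans ?_
    · nlinarith [mul_le_mul_of_nonneg_left (hfrac V) (Nat.cast_nonneg F)]
    · rw [coded_rate_eq_sub_delta hN hNK hMN]
      gcongr
  have hrandom : ∀ W d, ((randomDelivery (m := fun k => cacheSize N F (M k)) W d A).length : ℝ) ≤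
      (∑ i : Fin N, (1 - M (Fin.castLE hNK i) / N) + ε) * F := by
    intro W d
    refine (length_randomDelivery_le W d hNK hK (fun j k hjk => cacheSize_mono (hM hjk)) A).trans
      ((Finset.sum_le_sum fun i _ => sub_cacheSize_add_le (hMN _) s).trans ?_)
    rw [Finset.sum_add_distrib, ← Finset.sum_mul]
    simp only [Finset.sum_const, Finset.card_univ, Fintype.card_fin, nsmul_eq_mul]
    linarith
  have hlen : (gbdMsgLen C A : ℝ) ≤ (min
      ((∑ i : Fin K, ∏ j ∈ Finset.Iic i, (1 - M j / N)) - deltaR₁ N M - deltaR₂ N M)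
      (∑ i : Fin N, (1 - M (Fin.castLE hNK i) / N)) + ε) * F := by
    rcases min_cases ((∑ i : Fin K, ∏ j ∈ Finset.Iic i, (1 - M j / N)) - deltaR₁ N M - deltaR₂ N M)
      (∑ i : Fin N, (1 - M (Fin.castLE hNK i) / N)) with ⟨h, -⟩ | ⟨h, -⟩
    · rw [h]
      -- The bound is nonnegative because it dominates the length of an actual message.
      exact gbdMsgLen_le A ((Nat.cast_nonneg _).trans (hcoded 0 fun _ => ⟨0, hN⟩))
        fun W d => Or.inl (hcoded W d)
    · rw [h]
      exact gbdMsgLen_le A ((Nat.cast_nonneg _).trans (hrandom 0 fun _ => ⟨0, hN⟩))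
        fun W d => Or.inr (hrandom W d)
  exact ⟨ρ, fun k => mul_cacheSize_le hN (hM0 k), hlen, hρ.trans_lt hε⟩

end CodedCaching

theorem theorem1 (N K : ℕ) (hNK : N < K) (M : Fin K → ℝ) (hM : Monotone M)
    (hM0 : ∀ k, 0 ≤ M k) (hMN : ∀ k, M k < N) (R : ℝ)
    (hR : R = min
      ((∑ i : Fin K, ∏ j ∈ Finset.Iic i, (1 - M j / N))
        - CodedCaching.deltaR₁ N M - CodedCaching.deltaR₂ N M)
      (∑ i : Fin N, (1 - M (Fin.castLE hNK.le i) / N))) :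
    CodedCaching.GBDAchieves N M R ∧ CodedCaching.Achievable N M R := by
  have hN : 0 < N := by
    have h := (hM0 ⟨0, by omega⟩).trans_lt (hMN ⟨0, by omega⟩)
    exact_mod_cast h
  have h := CodedCaching.gbdAchieves hN hNK.le hM hM0 hMN
  rw [← hR] at h
  exact ⟨h, h.achievable⟩
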